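/- **Semirings.** Let $(D,\oplus,\otimes,\bar 0,\bar 1)$ be an idempotent semiring with the order $a\sqsubseteq b\iff a\oplus b=a$, and suppose that it has finite height $H$: the longest strictly $\sqsubseteq$-descending chain in $D$ has $H$ elements. The combine $\bigoplus S$ of a possibly infinite $S\subseteq D$ is its greatest lower bound for $\sqsubseteq$ ($\bar 0$ if $S=\emptyset$). **RSMs.** A recursive state machine $R$ over $D$ consists of finitely many modules. Module $i$ has finite sets of boxes $B_i$, internal nodes $In_i$, entries $En_i$ and exits $Ex_i$; a map $Y$ assigning to every box the module it calls; call nodes $(b,e)$ with $b\in B_i$, $e\in En_{Y(b)}$; return nodes $(b,x)$ with $b\in B_i$, $x\in Ex_{Y(b)}$, forming $Ret_i$; and weighted transitions $\delta_i$ from internal, entry and return nodes to internal, exit and call nodes of module $i$, those to exits having weight $\bar 1$. Let $|R|$ be the maximum of the total number of nodes and the total number of transitions, $|Call|$ the number of call nodes, and $\theta_e,\theta_x$ the maximal numbers of entries and of exits of a module. A configuration $\langle u,S\rangle$ is an internal, entry or return node $u$ with a stack $S=b_1\dots b_r$ of boxes (top first) such that $Y(b_1)$ is the module of $u$ and $Y(b_{j+1})$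 is the module containing $b_j$. A transition $(u,u')$ with $u'$ internal yields $\langle u,S\rangle\Rightarrow\langle u',S\rangle$; $(u,(b,e))$ yields $\langle u,S\rangle\Rightarrow\langle e,bS\rangle$; $(u,x)$ with $x$ an exit yields $\langle u,bS\rangle\Rightarrow\langle (b,x),S\rangle$; each with the weight of the transition. The weight of a computation is the $\otimes$-product of its weights in order. For a set $X$ of configurations, $dist(X,c)$ is the combine of the weights of all computations from elements of $X$ to $c$. **Automata.** An $R$-automaton $A$ has a finite set of states $(u,m)$, with $u$ an internal, entry or return node and $m$ a mark (from a fixed countably infinite set); a set $I$ of initial states; a set $F$ of final states, all with entry nodes; and weighted transitions of two kinds: $(e,m)\xrightarrow{b}(e',m')$ with $b\in B_i$, $e\in En_{Y(b)}$, $e'\in En_i$; and $(u,m)\xrightarrow{\varepsilon}(e,m')$ with $e\in En_i$ and $u\in In_i\cup Ret_i$, or $(u,m)=(e,m')$. Every entry state carries an $\varepsilon$-self-loop of weight $\bar 1$. The weight of a run is the product of the weights of its transitions in reverse order. An accepting run of $\langle u,S\rangle$ is a run labelled $S$ from an initial state $(u,m)$ to a final state; $A(c)$ is the combine of the weights of all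 accepting runs of $c$; and $L(A)$ is the set of configurations with an accepting run of weight $\ne\bar 0$. **Algorithm ConfDist.** Input: $R$, an $R$-automaton $A$ all of whose transitions have weight $\bar 1$, and a mark $\hat m$ not occurring in $A$. Write $wt$ for the current automaton weights and $w$ for the weights of $R$. *Preprocessing.* (1) For every internal, entry or return node $u$, add an initial state $(u,\hat m)$, with an $\varepsilon$-self-loop of weight $\bar 1$ if $u$ is an entry. (2) For every initial state $(u,m)$, every transition $(u,(b,e))$ of $R$ and every entry state $q'$ of the module of $u$, add $(e,\hat m)\xrightarrow{b}q'$ with weight $\bar 0$. (3) For every entry state $q$ and every internal or return node $u$ of its module, add $(u,\hat m)\xrightarrow{\varepsilon}q$ with weight $\bar 0$. *Initialization.* The worklist $WL$ consists of all $\varepsilon$-transitions of weight $\bar 1$ from initial states; $sum(q,x):=\bar 0$ for all entry states $q$ and exits $x$ of the module of $q$. *Relax*$(t,v)$: if $wt(t)\ne wt(t)\oplus v$, set $wt(t):=wt(t)\oplus v$ and add $t$ to $WL$. *Main loop.* While $WL\neq\emptyset$, extract any $t$ from $WL$. If $t=(u,m)\xrightarrow{\varepsilon}q$: for every transition $(u,u')$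 of $R$ with $u'$ internal, Relax$\big((u',\hat m)\xrightarrow{\varepsilon}q,\ wt(t)\otimes w(u,u')\big)$; for every transition $(u,(b,e'))$ of $R$, Relax$\big((e',\hat m)\xrightarrow{b}q,\ wt(t)\otimes w(u,(b,e'))\big)$, and add the $\varepsilon$-self-loop of $(e',\hat m)$ to $WL$ if it was never added before; for every transition $(u,x)$ of $R$ with $x$ an exit and $sum(q,x)\not\sqsubseteq wt(t)$, set $sum(q,x):=sum(q,x)\oplus wt(t)$ and then, for every transition $t'=(q\xrightarrow{b}q')$, Relax$\big(((b,x),\hat m)\xrightarrow{\varepsilon}q',\ wt(t')\otimes sum(q,x)\big)$. If $t=(e,m)\xrightarrow{b}q'$: for every exit $x$ of the module of $e$, Relax$\big(((b,x),\hat m)\xrightarrow{\varepsilon}q',\ wt(t)\otimes sum((e,\hat m),x)\big)$. When $WL=\emptyset$, output the current automaton $A_{post^*}$. Its final states are those of $A$. Time is counted in a unit-cost model: semiring operations, look-ups and updates of table entries, set insertions and deletions, tests and loop iterations take constant time, and each loop runs over a list of the items concerned. The extraction order and the order of all loops are arbitrary. **Theorem.** There is an absolute constant $C$ such that for all $D$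 (of height $H$), $R$, $A$ and $\hat m$ as above, with $\kappa$ the number of distinct marks occurring in $A$: every execution of ConfDist terminates without getting stuck, and its output $A_{post^*}$ is an $R$-automaton with $$dist(L(A),c)=A_{post^*}(c)\qquad\text{for every configuration }c,$$ where both combines exist. If $\kappa\ge 1$, then $A_{post^*}$ has exactly $\kappa+1$ marks. If moreover $\theta_e\ge1$, every execution takes at most $$C\cdot H\cdot\big(|R|\cdot\theta_e\cdot\kappa^2+|Call|\cdot\theta_e\cdot\theta_x\cdot\kappa^3\big)$$ steps. -/

import Mathlib

universe u v

/-- `HasHeight D H`: the longest strictly descending chain of the semiring `D` has `H` elements.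
In the canonical order `a ⊑ b ↔ a + b = a` of an idempotent semiring, smaller elements absorb
larger ones.  Mathlib orders an idempotent semiring the opposite way, `a ≤ b ↔ a + b = b`, so
descending chains for `⊑` are ascending chains for `≤`, and combining (the semiring sum) is
`≤`-supremum. -/
def HasHeight (D : Type u) [IdemSemiring D] (H : ℕ) : Prop :=
  IsGreatest {n : ℕ | ∃ a : Fin n → D, StrictMono a} H

/-- The combine `⨁ S` of a (possibly infinite) set `S` of weights exists and equals `d`: it is the
greatest lower bound for `⊑`, that is, the least upper bound for `≤`.  For `S = ∅` it is `0`, and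
for finite `S` it is the finite semiring sum. -/
def IsCombine {D : Type u} [IdemSemiring D] (S : Set D) (d : D) : Prop :=
  IsLUB S d

/-! ### Recursive state machines -/

/-- The modules, boxes and nodes of a recursive state machine.  The sets `B_i`, `In_i`, `En_i`,
`Ex_i` of the module `i` are the fibres over `i` of `boxMod`, `intMod`, `entryMod`, `exitMod`. -/
structure RSMFrame where
  Mod : Type v
  Box : Type v
  Int : Type v
  Entry : Type v
  Exit : Type v
  [finMod : Fintype Mod]
  [finBox : Fintype Box]
  [finInt : Fintype Int]
  [finEntry : Fintype Entry]
  [finExit : Fintype Exit]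
  /-- the module that contains a box -/
  boxMod : Box → Mod
  /-- the module that a box calls -/
  Y : Box → Mod
  intMod : Int → Mod
  entryMod : Entry → Mod
  exitMod : Exit → Mod

attribute [instance] RSMFrame.finMod RSMFrame.finBox RSMFrame.finInt RSMFrame.finEntry
  RSMFrame.finExit

namespace RSMFrame

variable (F : RSMFrame.{v})

/-- Call nodes `(b, e)`: `e` is an entry of the module called by the box `b`. -/
structure Call where
  box : F.Box
  entry : F.Entry
  entry_mod : F.entryMod entry = F.Y box

/-- Return nodes `(b, x)`: `x` is an exit of the module called by the box `b`. -/
structure Ret where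
  box : F.Box
  exit : F.Exit
  exit_mod : F.exitMod exit = F.Y box

/-- Internal, entry and return nodes: the sources of transitions, and the nodes of
configurations. -/
inductive Node where
  | int (i : F.Int)
  | entry (e : F.Entry)
  | ret (r : F.Ret)

/-- Internal, exit and call nodes: the targets of transitions. -/
inductive Target where
  | int (i : F.Int)
  | exit (x : F.Exit)
  | call (c : F.Call)

instance : Finite F.Call :=
  Finite.of_injective (fun c => (c.box, c.entry))
    (fun c c' h => by cases c; cases c'; simp_all)

instance : Finite F.Ret :=
  Finite.of_injective (fun r => (r.box, r.exit))
    (fun r r' h => by cases r; cases r'; simp_all)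

instance : Finite F.Node :=
  Finite.of_surjective
    (fun s : F.Int ⊕ F.Entry ⊕ F.Ret =>
      match s with
      | .inl i => Node.int i
      | .inr (.inl e) => Node.entry e
      | .inr (.inr r) => Node.ret r)
    (fun n => match n with
      | .int i => ⟨.inl i, rfl⟩
      | .entry e => ⟨.inr (.inl e), rfl⟩
      | .ret r => ⟨.inr (.inr r), rfl⟩)

noncomputable instance : Fintype F.Call := Fintype.ofFinite _
noncomputable instance : Fintype F.Ret := Fintype.ofFinite _
noncomputable instance : Fintype F.Node := Fintype.ofFinite _

variable {F}

/-- The module of an internal, entry or return node. -/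
def Node.mod : F.Node → F.Mod
  | .int i => F.intMod i
  | .entry e => F.entryMod e
  | .ret r => F.boxMod r.box

/-- The module of an internal, exit or call node. -/
def Target.mod : F.Target → F.Mod
  | .int i => F.intMod i
  | .exit x => F.exitMod x
  | .call c => F.boxMod c.box

def Node.IsEntry : F.Node → Prop
  | .entry _ => True
  | _ => False

end RSMFrame

/-- A recursive state machine over the idempotent semiring `D`.  The set `delta` is the union of
the transition relations of the modules, and `w` is the weight function (only its values on
`delta` matter). -/
structure RSM (D : Type u) [IdemSemiring D] extends RSMFrame.{v} where
  delta : Finset (toRSMFrame.Node × toRSMFrame.Target)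
  w : toRSMFrame.Node × toRSMFrame.Target → D
  delta_mod : ∀ t ∈ delta, t.1.mod = t.2.mod
  w_exit : ∀ u x, (u, .exit x) ∈ delta → w (u, .exit x) = 1

namespace RSM

variable {D : Type u} [IdemSemiring D] (R : RSM.{u, v} D)

/-- The total number of nodes (internal, entry, exit, call and return nodes). -/
noncomputable def numNodes : ℕ :=
  Fintype.card R.Int + Fintype.card R.Entry + Fintype.card R.Exit + Fintype.card R.Call
    + Fintype.card R.Ret

/-- The size `|R| = max (|N|, ∑ |δ_i|)`. -/
noncomputable def size : ℕ := max R.numNodes R.delta.card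

noncomputable def numCalls : ℕ := Fintype.card R.Call

open scoped Classical in
/-- `θ_e`: the maximal number of entries of a module. -/
noncomputable def entryBound : ℕ :=
  Finset.univ.sup fun i : R.Mod => (Finset.univ.filter fun e : R.Entry => R.entryMod e = i).card

open scoped Classical in
/-- `θ_x`: the maximal number of exits of a module. -/
noncomputable def exitBound : ℕ :=
  Finset.univ.sup fun i : R.Mod => (Finset.univ.filter fun x : R.Exit => R.exitMod x = i).card

/-! ### Configurations, computations, distance -/

/-- `ValidStack i S`: the stack `S` (top first) is a legal calling context for the module `i`. -/
def ValidStack : R.Mod → List R.Box → Prop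
  | _, [] => True
  | i, b :: S => R.Y b = i ∧ ValidStack (R.boxMod b) S

/-- A configuration: an internal, entry or return node with a legal stack. -/
structure Config where
  node : R.Node
  stack : List R.Box
  valid : R.ValidStack node.mod stack

variable {R}

/-- `Step c v c'`: there is a transition of weight `v` from the configuration `c` to `c'`. -/
inductive Step : R.Config → D → R.Config → Prop
  | internal (c c' : R.Config) (i : R.Int) (hd : (c.node, .int i) ∈ R.delta)
      (hn : c'.node = .int i) (hs : c'.stack = c.stack) :
      Step c (R.w (c.node, .int i)) c'
  | call (c c' : R.Config) (a : R.Call) (hd : (c.node, .call a) ∈ R.delta)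
      (hn : c'.node = .entry a.entry) (hs : c'.stack = a.box :: c.stack) :
      Step c (R.w (c.node, .call a)) c'
  | ret (c c' : R.Config) (r : R.Ret) (hd : (c.node, .exit r.exit) ∈ R.delta)
      (hn : c'.node = .ret r) (hs : c.stack = r.box :: c'.stack) :
      Step c (R.w (c.node, .exit r.exit)) c'

/-- `Computation c v c'`: there is a computation from `c` to `c'` of weight `v`, the product of the
weights of its transitions in order. -/
inductive Computation : R.Config → D → R.Config → Prop
  | refl (c : R.Config) : Computation c 1 c
  | step {c c' c'' : R.Config} {v w : D} (hp : Computation c v c') (hs : Step c' w c'') :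
      Computation c (v * w) c''

/-- The configuration distance from the set `S` of configurations to `c` is `d`: the combine of the
weights of all computations from a configuration of `S` to `c` is `d`. -/
def IsDist (S : Set R.Config) (c : R.Config) (d : D) : Prop :=
  IsCombine {v : D | ∃ c₀ ∈ S, Computation c₀ v c} d

end RSM

/-! ### Configuration automata -/

/-- The countably infinite set of marks. -/
abbrev Mark := ℕ

namespace RSM

variable {D : Type u} [IdemSemiring D]

/-- Automaton states: nodes with a mark. -/
abbrev State (R : RSM.{u, v} D) := R.Node × Mark

/-- An automaton transition.  The label `none` is `ε`, the label `some b` is the box `b`. -/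
structure Trans (R : RSM.{u, v} D) where
  src : R.State
  label : Option R.Box
  tgt : R.State

/-- The admissible forms of transitions.
* `b`-transitions lead from an entry of the module called by `b` to an entry of the module that
  contains `b`.
* `ε`-transitions lead from an internal or return node to an entry of the same module, or are
  self-loops of an entry state. -/
def Trans.WellFormed {R : RSM.{u, v} D} (t : R.Trans) : Prop :=
  match t.label with
  | some b => t.src.1.IsEntry ∧ t.src.1.mod = R.Y b ∧ t.tgt.1.IsEntry ∧ t.tgt.1.mod = R.boxMod b
  | none => t.tgt.1.IsEntry ∧
      ((¬ t.src.1.IsEntry ∧ t.src.1.mod = t.tgt.1.mod) ∨ t.src = t.tgt)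

/-- The data of a weighted finite automaton: states, transitions, initial states, final states and
weights (only the weights of elements of `trans` matter). -/
structure Aut (R : RSM.{u, v} D) where
  Q : Finset R.State
  trans : Finset R.Trans
  I : Finset R.State
  F : Finset R.State
  wt : R.Trans → D

namespace Aut

variable {R : RSM.{u, v} D}

/-- `A` is a configuration automaton (an `R`-automaton).  Every entry state carries an
`ε`-self-loop of weight `1`. -/
structure IsConfigAut (A : R.Aut) : Prop where
  src_mem : ∀ t ∈ A.trans, t.src ∈ A.Q
  tgt_mem : ∀ t ∈ A.trans, t.tgt ∈ A.Q
  wellFormed : ∀ t ∈ A.trans, t.WellFormed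
  init_sub : A.I ⊆ A.Q
  final_sub : A.F ⊆ A.Q
  final_entry : ∀ q ∈ A.F, q.1.IsEntry
  loop_mem : ∀ q ∈ A.Q, q.1.IsEntry → Trans.mk q none q ∈ A.trans
  loop_wt : ∀ q ∈ A.Q, q.1.IsEntry → A.wt (Trans.mk q none q) = 1

/-- The marks that occur in `A`. -/
def marks (A : R.Aut) : Finset Mark := A.Q.image Prod.snd

/-- `Run q S v q'`: there is a run of `A` from `q` to `q'` labelled by the stack `S` and of weight
`v`.  The weights of the transitions are multiplied in reverse order. -/
inductive Run (A : R.Aut) : R.State → List R.Box → D → R.State → Prop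
  | refl (q : R.State) (hq : q ∈ A.Q) : Run A q [] 1 q
  | cons {t : R.Trans} {S : List R.Box} {v : D} {q : R.State} (ht : t ∈ A.trans)
      (hr : Run A t.tgt S v q) : Run A t.src (t.label.toList ++ S) (v * A.wt t) q

/-- There is an accepting run of `A` for the configuration `c` of weight `v`. -/
def AcceptingRun (A : R.Aut) (c : R.Config) (v : D) : Prop :=
  ∃ m : Mark, (c.node, m) ∈ A.I ∧ ∃ q ∈ A.F, A.Run (c.node, m) c.stack v q

/-- The language of `A`: the configurations with an accepting run of non-zero weight. -/
def language (A : R.Aut) : Set R.Config := {c | ∃ v : D, v ≠ 0 ∧ A.AcceptingRun c v}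

/-- The weight that `A` assigns to `c`, the combine of the weights of all accepting runs of `c`,
is `d`. -/
def IsWeight (A : R.Aut) (c : R.Config) (d : D) : Prop :=
  IsCombine {v : D | A.AcceptingRun c v} d

end Aut

end RSM

/-! ### Nondeterministic programs with a step count -/

/-- A nondeterministic program on memories of type `σ`: to an initial memory it assigns the possible
pairs of a final memory and a number of elementary steps.  This is a unit-cost model: an update of
one table entry (with boundedly many semiring operations and look-ups), an insertion into or a
deletion from a set, a test, and a loop iteration are one step each. -/
def Prog (σ : Type*) := σ → Set (σ × ℕ)

namespace Prog

variable {σ : Type*}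

/-- An elementary step, of cost one. -/
def act (f : σ → σ) : Prog σ := fun s => {(f s, 1)}

/-- Sequential composition. -/
def seq (p q : Prog σ) : Prog σ := fun s =>
  {r | ∃ r₁ ∈ p s, ∃ r₂ ∈ q r₁.1, r = (r₂.1, r₁.2 + r₂.2)}

infixr:60 " ;; " => Prog.seq

open scoped Classical in
/-- Conditional execution; the test costs one step. -/
noncomputable def when (c : σ → Prop) (p : Prog σ) : Prog σ :=
  act id ;; fun s => if c s then p s else {(s, 0)}

/-- Execute `f a` for the elements `a` of a list, in order; every iteration and the end of the loop
cost one step. -/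
def forList {α : Type*} (f : α → Prog σ) : List α → Prog σ
  | [] => act id
  | a :: l => act id ;; f a ;; forList f l

/-- Execute `f a` for all elements `a` of the finite set `S s`, where `s` is the memory at the start
of the loop, in an arbitrary order.  The elements are taken from a list (an adjacency list, say), so
that the loop costs one step for every element, and one more, in addition to its bodies. -/
def forEach {α : Type*} (S : σ → Finset α) (f : α → Prog σ) : Prog σ := fun s =>
  {r | ∃ l : List α, l.Nodup ∧ (∀ a, a ∈ l ↔ a ∈ S s) ∧ r ∈ forList f l s}

end Prog

/-! ### The algorithm `ConfDist` -/

namespace ConfDist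

open RSM

variable {D : Type u} [IdemSemiring D] {R : RSM.{u, v} D}

/-- The memory of the algorithm: the current automaton, the worklist, the transitions that were
added to the worklist so far, and the summary function. -/
structure Mem (R : RSM.{u, v} D) where
  aut : R.Aut
  WL : Finset R.Trans
  added : Finset R.Trans
  sum : R.State → R.Exit → D

open scoped Classical in
noncomputable def addState (q : R.State) (s : Mem R) : Mem R :=
  { s with aut := { s.aut with Q := insert q s.aut.Q } }

open scoped Classical in
noncomputable def addInit (q : R.State) (s : Mem R) : Mem R :=
  { s with aut := { s.aut with I := insert q s.aut.I } }

open scoped Classical in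
noncomputable def setWt (t : R.Trans) (d : D) (s : Mem R) : Mem R :=
  { s with aut := { s.aut with wt := Function.update s.aut.wt t d } }

open scoped Classical in
/-- Add a transition, with the given weight, to the automaton. -/
noncomputable def addTrans (t : R.Trans) (d : D) (s : Mem R) : Mem R :=
  setWt t d { s with aut := { s.aut with trans := insert t s.aut.trans } }

open scoped Classical in
noncomputable def addWL (t : R.Trans) (s : Mem R) : Mem R :=
  { s with WL := insert t s.WL, added := insert t s.added }

open scoped Classical in
noncomputable def setSum (q : R.State) (x : R.Exit) (d : D) (s : Mem R) : Mem R :=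
  { s with sum := Function.update s.sum q (Function.update (s.sum q) x d) }

open scoped Classical in
/-- The call nodes `c` with `⟨u, c⟩ ∈ δ`. -/
noncomputable def callsFrom (u : R.Node) : Finset R.Call :=
  Finset.univ.filter fun c => (u, .call c) ∈ R.delta

open scoped Classical in
/-- The internal nodes `i` with `⟨u, i⟩ ∈ δ`. -/
noncomputable def intsFrom (u : R.Node) : Finset R.Int :=
  Finset.univ.filter fun i => (u, .int i) ∈ R.delta

open scoped Classical in
/-- The exits `x` with `⟨u, x⟩ ∈ δ`. -/
noncomputable def exitsFrom (u : R.Node) : Finset R.Exit :=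
  Finset.univ.filter fun x => (u, .exit x) ∈ R.delta

open scoped Classical in
/-- The current entry states. -/
noncomputable def entryStates (s : Mem R) : Finset R.State :=
  s.aut.Q.filter fun q => q.1.IsEntry

open scoped Classical in
/-- The current entry states of the module `i`. -/
noncomputable def entryStatesOf (i : R.Mod) (s : Mem R) : Finset R.State :=
  s.aut.Q.filter fun q => q.1.IsEntry ∧ q.1.mod = i

/-- Preprocessing with the fresh mark `m`. -/
noncomputable def preprocess (m : Mark) : Prog (Mem R) :=
  (.forEach (fun _ => (Finset.univ : Finset R.Node)) fun u =>
    .act (addState (u, m)) ;;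
    .act (addInit (u, m)) ;;
    .when (fun _ => u.IsEntry) (.act (addTrans ⟨(u, m), none, (u, m)⟩ 1))) ;;
  (.forEach (fun s => s.aut.I) fun q =>
    .forEach (fun _ => callsFrom q.1) fun c =>
      .forEach (entryStatesOf q.1.mod) fun q' =>
        .act (addTrans ⟨(.entry c.entry, m), some c.box, q'⟩ 0)) ;;
  (.forEach entryStates fun q =>
    .forEach (fun _ => open scoped Classical in
        Finset.univ.filter fun u : R.Node => ¬ u.IsEntry ∧ u.mod = q.1.mod) fun u =>
      .act (addTrans ⟨(u, m), none, q⟩ 0))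

/-- Initialization of the worklist and of the summary function. -/
noncomputable def initStep : Prog (Mem R) :=
  (.forEach (fun s => s.aut.trans) fun t =>
    .when (fun s => t.label = none ∧ t.src ∈ s.aut.I ∧ s.aut.wt t = 1) (.act (addWL t))) ;;
  (.forEach entryStates fun q =>
    .forEach (fun _ => open scoped Classical in
        Finset.univ.filter fun x : R.Exit => R.exitMod x = q.1.mod) fun x =>
      .act (setSum q x 0))

/-- `Relax (t, d)`, where `d` is evaluated in the current memory. -/
noncomputable def relax (t : R.Trans) (d : Mem R → D) : Prog (Mem R) := fun s =>
  Prog.when (fun s => s.aut.wt t ≠ s.aut.wt t + d s)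
    (.act (fun s => setWt t (s.aut.wt t + d s) s) ;; .act (addWL t)) s

/-- The loop body for an `ε`-transition `t` from `(u, m_u)` to `(e, m_e)`. -/
noncomputable def processEps (m : Mark) (t : R.Trans) : Prog (Mem R) :=
  -- internal transitions
  (.forEach (fun _ => intsFrom t.src.1) fun i =>
    relax ⟨(.int i, m), none, t.tgt⟩ (fun s => s.aut.wt t * R.w (t.src.1, .int i))) ;;
  -- call transitions
  (.forEach (fun _ => callsFrom t.src.1) fun c =>
    relax ⟨(.entry c.entry, m), some c.box, t.tgt⟩
      (fun s => s.aut.wt t * R.w (t.src.1, .call c)) ;;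
    .when (fun s => ⟨(.entry c.entry, m), none, (.entry c.entry, m)⟩ ∉ s.added)
      (.act (addWL ⟨(.entry c.entry, m), none, (.entry c.entry, m)⟩))) ;;
  -- exit transitions; the inner loop runs over the `b`-transitions that leave `t.tgt`, each given
  -- by the return node `(b, x)` and the target of the transition
  (.forEach (fun _ => exitsFrom t.src.1) fun x =>
    .when (fun s => s.sum t.tgt x + s.aut.wt t ≠ s.sum t.tgt x)
      (.act (fun s => setSum t.tgt x (s.sum t.tgt x + s.aut.wt t) s) ;;
        .forEach (fun s => open scoped Classical in
          (Finset.univ ×ˢ s.aut.Q).filter fun p : R.Ret × R.State =>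
            p.1.exit = x ∧ ⟨t.tgt, some p.1.box, p.2⟩ ∈ s.aut.trans) fun p =>
          relax ⟨(.ret p.1, m), none, p.2⟩
            (fun s => s.aut.wt ⟨t.tgt, some p.1.box, p.2⟩ * s.sum t.tgt x)))

/-- The loop body for a transition `t` from `(e, m_e)` to `(e', m_e')` labelled by the box `b`.  The
loop over the exits `x` of the module called by `b` is a loop over the return nodes `(b, x)`. -/
noncomputable def processBox (m : Mark) (t : R.Trans) (b : R.Box) : Prog (Mem R) :=
  .forEach (fun _ => open scoped Classical in
    Finset.univ.filter fun r : R.Ret => r.box = b) fun r =>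
    relax ⟨(.ret r, m), none, t.tgt⟩ (fun s => s.aut.wt t * s.sum (t.src.1, m) r.exit)

open scoped Classical in
/-- One iteration of the main loop, in which `t` is extracted from the worklist. -/
noncomputable def iteration (m : Mark) (t : R.Trans) : Prog (Mem R) :=
  .act (fun s => { s with WL := s.WL.erase t }) ;;
  .act id ;;
  match t.label with
  | none => processEps m t
  | some b => processBox m t b

/-- The memory at the start: the input automaton is stored, everything else is blank. -/
def start (A : R.Aut) : Mem R where
  aut := A
  WL := ∅
  added := ∅
  sum := fun _ _ => 0

/-- `Reaches m A s n`: some execution of `ConfDist` on the input `A` with the fresh mark `m` arrives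
at the head of the main loop with memory `s` after `n` elementary steps.  In every iteration an
arbitrary element of the worklist is extracted.  The execution halts there if and only if the
worklist `s.WL` is empty, and the output is then the automaton `s.aut`. -/
inductive Reaches (m : Mark) (A : R.Aut) : Mem R → ℕ → Prop
  | init {s : Mem R} {n : ℕ} (h : (s, n) ∈ (preprocess m ;; initStep) (start A)) :
      Reaches m A s n
  | step {s s' : Mem R} {n k : ℕ} (hr : Reaches m A s n) (t : R.Trans) (ht : t ∈ s.WL)
      (h : (s', k) ∈ iteration m t s) : Reaches m A s' (n + k)

end ConfDist

/-! Correctness is the pair of inequalities between the distance and the weight of the output, both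
read as suprema for `≤`.

No infinite distributive law is assumed. It follows from finite height: the combine of any set is
already the combine of a finite subset (`exists_finset_isLUB`), so multiplication passes through it.

Upper bound. Let `m` be the fresh mark. An `ε`-transition from `(u, m)` to `q` summarizes
computations that end in `u` with empty stack, and a `b`-transition from `(e, m)` to `q` those that
end in `e` with stack `b`. They start from the `origins` of `q`: the node of `q` itself with empty
stack if `q` has mark `m`, and otherwise every node and stack prefix that leads `A` from an initial
state to `q`. No relaxation raises a weight above the combine of the computations it summarizes
(`wtBound`, `sumBound`); the delicate case is a return, `mul_sumBound_le`. An accepting run of the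
output then composes such computations, and since no transition leads from an old state to a new
one, it ends with a run of `A` (`Base.suffixBound`).

Lower bound. For every transition of the automaton and every matching transition of `R` there is an
inequality (`Goal.Closed`), which the main loop keeps true except when the transition is waiting in
the worklist. When the worklist is empty, all of them hold, and they carry the bound along one step
of a computation (`Inv.step_le`), hence along whole computations.

Cost. Every update strictly increases a weight or a summary, so its `chainRank`, a number at most
`H`, drops. The potential charges each transition its processing cost times its rank, plus once more
while it waits in the worklist, and each summary the cost of its return loop times its rank. An
iteration then has amortized cost zero (`hoare_iteration`), and the step bound is the setup cost
plus the maximal potential. Counting reduces to degree sums and to the injection in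
`sum_card_mul_card_le`. -/

/-! ### Combines and ranks in semirings of finite height -/

section Height

variable {D : Type u} [IdemSemiring D]

/-- The length of the longest strictly increasing chain of elements above `d`. -/
noncomputable def chainRank (d : D) : ℕ :=
  sSup {n : ℕ | ∃ a : Fin n → D, StrictMono a ∧ ∀ i, d ≤ a i}

theorem HasHeight.bddAbove {H : ℕ} (hH : HasHeight D H) (d : D) :
    H ∈ upperBounds {n : ℕ | ∃ a : Fin n → D, StrictMono a ∧ ∀ i, d ≤ a i} :=
  fun _ ⟨a, ha, _⟩ => hH.2 ⟨a, ha⟩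

theorem HasHeight.chainRank_le {H : ℕ} (hH : HasHeight D H) (d : D) : chainRank d ≤ H :=
  csSup_le' (hH.bddAbove d)

/-- A longest chain above `d'` can be extended below by `d`. This strict drop is what pays for every
update of the algorithm. -/
theorem HasHeight.chainRank_lt {H : ℕ} (hH : HasHeight D H) {d d' : D} (h : d < d') :
    chainRank d' < chainRank d := by
  -- The supremum is attained because the set of lengths is bounded by `H` and contains the empty
  -- chain.
  obtain ⟨a, ha, hd⟩ : chainRank d' ∈ {n : ℕ | ∃ a : Fin n → D, StrictMono a ∧ ∀ i, d' ≤ a i} :=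
    Nat.sSup_mem ⟨0, Fin.elim0, fun i => i.elim0, fun i => i.elim0⟩ ⟨H, hH.bddAbove d'⟩
  refine Nat.lt_of_succ_le (le_csSup ⟨H, hH.bddAbove d⟩ ⟨Fin.cons d a, ?_, ?_⟩)
  · intro i j hij
    induction j using Fin.cases with
    | zero => exact absurd hij (Fin.not_lt_zero i)
    | succ j =>
      induction i using Fin.cases with
      | zero => simpa using h.trans_le (hd j)
      | succ i => simpa using ha (Fin.succ_lt_succ_iff.1 hij)
  · intro i
    induction i using Fin.cases with
    | zero => simp
    | succ i => simpa using h.le.trans (hd i)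

theorem HasHeight.wellFoundedGT {H : ℕ} (hH : HasHeight D H) : WellFoundedGT D :=
  ⟨Subrelation.wf (fun {_ _} h => hH.chainRank_lt h) (measure (chainRank (D := D))).wf⟩

theorem HasHeight.pos {H : ℕ} (hH : HasHeight D H) : 0 < H :=
  hH.2 ⟨fun _ => (0 : D), fun i j h => by simp [Subsingleton.elim i j] at h⟩

/-- Only finite sums commute with multiplication in the semiring; `f 0 = 0` is the case of the empty
sum. -/
theorem finset_sup_le_of_map {T : Finset D} {f : D → D} {x : D} (h0 : f 0 = 0)
    (hadd : ∀ a b, f (a + b) = f a + f b) (h : ∀ v ∈ T, f v ≤ x) : f (T.sup id) ≤ x := by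
  classical
  induction T using Finset.induction_on with
  | empty => rw [Finset.sup_empty, bot_eq_zero, h0]; exact zero_le
  | insert a T _ ih =>
    rw [Finset.sup_insert, ← add_eq_sup, hadd, add_eq_sup]
    exact sup_le (h a (Finset.mem_insert_self a T))
      (ih fun v hv => h v (Finset.mem_insert_of_mem hv))

variable [WellFoundedGT D]

/-- Among the suprema of finite subsets of `S` one is maximal. Inserting another element of `S`
cannot raise it, so it bounds all of `S`. -/
theorem exists_finset_isLUB (S : Set D) :
    ∃ T : Finset D, (T : Set D) ⊆ S ∧ IsLUB S (T.sup id) := by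
  classical
  obtain ⟨M, ⟨T, hT, rfl⟩, hmax⟩ := WellFounded.has_min (wellFounded_gt (α := D))
    {M | ∃ T : Finset D, (T : Set D) ⊆ S ∧ T.sup id = M} ⟨_, ∅, by simp, rfl⟩
  refine ⟨T, hT, fun x hx => ?_, fun b hb => Finset.sup_le fun x hx => hb (hT hx)⟩
  by_contra hlt
  refine hmax ((insert x T).sup id) ⟨insert x T, ?_, rfl⟩ ?_
  · intro y hy
    rcases Finset.mem_insert.1 (Finset.mem_coe.1 hy) with rfl | hy
    exacts [hx, hT hy]
  · rw [Finset.sup_insert]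
    exact lt_of_le_of_ne le_sup_right fun h => hlt (by rw [h]; exact le_sup_left)

/-- The combine of a set of weights. -/
noncomputable def combine (S : Set D) : D := (exists_finset_isLUB S).choose.sup id

theorem isLUB_combine (S : Set D) : IsLUB S (combine S) := (exists_finset_isLUB S).choose_spec.2

theorem le_combine {S : Set D} {v : D} (h : v ∈ S) : v ≤ combine S := (isLUB_combine S).1 h

theorem combine_le {S : Set D} {x : D} (h : ∀ v ∈ S, v ≤ x) : combine S ≤ x :=
  (isLUB_combine S).2 h

theorem combine_mul_le {S : Set D} {a x : D} (h : ∀ v ∈ S, v * a ≤ x) : combine S * a ≤ x :=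
  finset_sup_le_of_map (f := (· * a)) (zero_mul a) (fun b c => add_mul b c a)
    fun v hv => h v ((exists_finset_isLUB S).choose_spec.1 hv)

theorem mul_combine_le {S : Set D} {a x : D} (h : ∀ v ∈ S, a * v ≤ x) : a * combine S ≤ x :=
  finset_sup_le_of_map (f := (a * ·)) (mul_zero a) (fun b c => mul_add a b c)
    fun v hv => h v ((exists_finset_isLUB S).choose_spec.1 hv)

/-- The form in which concatenation of computations is used: a bound for all products of
representatives bounds the product of the combines. -/
theorem combine_mul_combine_le {S T : Set D} {x : D} (h : ∀ v ∈ S, ∀ w ∈ T, v * w ≤ x) :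
    combine S * combine T ≤ x :=
  combine_mul_le fun v hv => mul_combine_le fun w hw => h v hv w hw

end Height

/-! ### A program logic with costs and a potential -/

namespace Prog

variable {σ : Type*}

/-- Every execution of `p` from a memory with `P` ends in a memory with `Q`, at an amortized cost
of at most `c` with respect to the potential `Φ`. -/
def Hoare (Φ : σ → ℕ) (P : σ → Prop) (p : Prog σ) (c : ℕ) (Q : σ → Prop) : Prop :=
  ∀ s, P s → ∀ r ∈ p s, Q r.1 ∧ r.2 + Φ r.1 ≤ Φ s + c

namespace Hoare

variable {Φ : σ → ℕ} {P P' Q Q' : σ → Prop} {p q : Prog σ} {c c' : ℕ}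

theorem weaken (h : Hoare Φ P p c Q) (hP : ∀ s, P' s → P s) (hQ : ∀ s, Q s → Q' s)
    (hc : c ≤ c') : Hoare Φ P' p c' Q' := fun s hs r hr =>
  ⟨hQ _ (h s (hP s hs) r hr).1, (h s (hP s hs) r hr).2.trans (by omega)⟩

theorem act {f : σ → σ} (h : ∀ s, P s → Q (f s) ∧ 1 + Φ (f s) ≤ Φ s + c) :
    Hoare Φ P (Prog.act f) c Q := by
  rintro s hs r rfl
  exact h s hs

theorem seq {M : σ → Prop} (h₁ : Hoare Φ P p c M) (h₂ : Hoare Φ M q c' Q) :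
    Hoare Φ P (p ;; q) (c + c') Q := by
  rintro s hs _ ⟨r₁, hr₁, r₂, hr₂, rfl⟩
  obtain ⟨h, hc⟩ := h₁ s hs r₁ hr₁
  obtain ⟨h', hc'⟩ := h₂ _ h r₂ hr₂
  exact ⟨h', by dsimp only; omega⟩

/-- An elementary step that releases potential pays for the rest of the program. -/
theorem act_seq_of_release {M : σ → Prop} {f : σ → σ} {g k : ℕ}
    (h : ∀ s, P s → M (f s) ∧ Φ (f s) + g ≤ Φ s) (h₂ : Hoare Φ M q c Q) (hk : 1 + c ≤ g + k) :
    Hoare Φ P (Prog.act f ;; q) k Q := by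
  rintro s hs _ ⟨r₁, hr₁, r₂, hr₂, rfl⟩
  obtain rfl : r₁ = (f s, 1) := hr₁
  obtain ⟨h, hc⟩ := h s hs
  obtain ⟨h', hc'⟩ := h₂ _ h r₂ hr₂
  exact ⟨h', by dsimp only at *; omega⟩

theorem when {b : σ → Prop} (h : Hoare Φ (fun s => P s ∧ b s) p c Q)
    (h' : ∀ s, P s → ¬ b s → Q s) : Hoare Φ P (Prog.when b p) (c + 1) Q := by
  rintro s hs _ ⟨r₁, hr₁, r₂, hr₂, rfl⟩
  obtain rfl : r₁ = (s, 1) := hr₁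
  by_cases hb : b s
  · simp only [hb, if_true] at hr₂
    obtain ⟨h₁, h₂⟩ := h s ⟨hs, hb⟩ r₂ hr₂
    exact ⟨h₁, by dsimp only; omega⟩
  · simp only [hb, if_false, Set.mem_singleton_iff] at hr₂
    subst hr₂
    exact ⟨h' s hs hb, by dsimp only; omega⟩

/-- The rule for loops.  The assertion `K X` says that the facts in `X` are established; the
iteration for `a` establishes the facts in `o a`. -/
theorem forEach {α β : Type*} {K : Set β → σ → Prop} {X : Set β} {S : σ → Finset α}
    {T : Finset α} {f : α → Prog σ} {k : α → ℕ} (o : α → Set β) (hS : ∀ s, K X s → S s = T)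
    (hbody : ∀ a ∈ T, ∀ Y, X ⊆ Y → Hoare Φ (K Y) (f a) (k a) (K (Y ∪ o a))) :
    Hoare Φ (K X) (Prog.forEach S f) (∑ a ∈ T, (k a + 1) + 1) (K (X ∪ ⋃ a ∈ T, o a)) := by
  classical
  rintro s hs r ⟨l, hl, hmem, hr⟩
  -- Facts only accumulate, as a union, so the outcome does not depend on the order in which the
  -- list enumerates the set. The set `Y` must be general for the induction.
  have key : ∀ (l : List α), (∀ a ∈ l, a ∈ T) → ∀ Y, X ⊆ Y →
      Hoare Φ (K Y) (forList f l) ((l.map fun a => k a + 1).sum + 1)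
        (K (Y ∪ ⋃ a ∈ l, o a)) := by
    intro l
    induction l with
    | nil =>
      intro _ Y _
      exact act fun _ hs => ⟨by simpa using hs, by simp [add_comm]⟩
    | cons a l ih =>
      intro hl Y hY
      have h₁ := hbody a (hl a (by simp)) Y hY
      have h₂ := ih (fun b hb => hl b (by simp [hb])) (Y ∪ o a) (hY.trans Set.subset_union_left)
      have h₀ : Hoare Φ (K Y) (Prog.act id) 1 (K Y) :=
        act fun _ hs => ⟨hs, by simp [add_comm]⟩
      refine (h₀.seq (h₁.seq h₂)).weaken (fun _ h => h) (fun _ h => ?_) ?_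
      · have : Y ∪ o a ∪ ⋃ b ∈ l, o b = Y ∪ ⋃ b ∈ a :: l, o b := by
          ext x; simp [or_assoc]
        rwa [this] at h
      · simp only [List.map_cons, List.sum_cons]; omega
  have hT : l.toFinset = T := by
    ext a; rw [List.mem_toFinset, hmem, hS s hs]
  have h := key l (fun a ha => by rw [← hT]; exact List.mem_toFinset.2 ha) X subset_rfl s hs r hr
  have h1 : (l.map fun a => k a + 1).sum = ∑ a ∈ T, (k a + 1) := by
    rw [← hT, List.sum_toFinset _ hl]
  have h2 : (⋃ a ∈ l, o a) = ⋃ a ∈ T, o a := by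
    ext x; simp [← hT]
  rwa [h1, h2] at h

end Hoare

/-- `p` has an execution from every memory. -/
def Total (p : Prog σ) : Prop := ∀ s, (p s).Nonempty

theorem Total.act (f : σ → σ) : Total (Prog.act f) := fun _ => ⟨_, rfl⟩

theorem Total.seq {p q : Prog σ} (hp : Total p) (hq : Total q) : Total (p ;; q) := fun s =>
  let ⟨r, hr⟩ := hp s
  let ⟨r', hr'⟩ := hq r.1
  ⟨_, r, hr, r', hr', rfl⟩

theorem Total.when {b : σ → Prop} {p : Prog σ} (hp : Total p) : Total (Prog.when b p) :=
  (Total.act id).seq fun s => by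
    by_cases hb : b s
    · simpa [hb] using hp s
    · simp [hb]

theorem Total.forEach {α : Type*} {S : σ → Finset α} {f : α → Prog σ} (hf : ∀ a, Total (f a)) :
    Total (Prog.forEach S f) := fun s => by
  have key : ∀ l : List α, Total (forList f l) := by
    intro l
    induction l with
    | nil => exact Total.act id
    | cons a l ih => exact (Total.act id).seq ((hf a).seq ih)
  obtain ⟨r, hr⟩ := key (S s).toList s
  exact ⟨r, (S s).toList, Finset.nodup_toList _, fun a => Finset.mem_toList, hr⟩

end Prog

/-! ### Computations on bare pairs of a node and a stack -/

namespace RSM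

variable {D : Type u} [IdemSemiring D] {R : RSM.{u, v} D}

/-- One step of a computation, without the requirement that the stack be legal. -/
inductive RawStep : R.Node × List R.Box → D → R.Node × List R.Box → Prop
  | internal {u : R.Node} {i : R.Int} (S : List R.Box) (hd : (u, .int i) ∈ R.delta) :
      RawStep (u, S) (R.w (u, .int i)) (.int i, S)
  | call {u : R.Node} {a : R.Call} (S : List R.Box) (hd : (u, .call a) ∈ R.delta) :
      RawStep (u, S) (R.w (u, .call a)) (.entry a.entry, a.box :: S)
  | ret {u : R.Node} {r : R.Ret} (S : List R.Box) (hd : (u, .exit r.exit) ∈ R.delta) :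
      RawStep (u, r.box :: S) (R.w (u, .exit r.exit)) (.ret r, S)

/-- Computations, without the requirement that the stacks be legal. -/
inductive RawComp : R.Node × List R.Box → D → R.Node × List R.Box → Prop
  | refl (c) : RawComp c 1 c
  | step {c c' c''} {v w : D} (hp : RawComp c v c') (hs : RawStep c' w c'') :
      RawComp c (v * w) c''

theorem RawComp.trans {c c' c'' : R.Node × List R.Box} {v w : D} (h : RawComp c v c')
    (h' : RawComp c' w c'') : RawComp c (v * w) c'' := by
  induction h' with
  | refl => simpa using h
  | step _ hs ih => rw [← mul_assoc]; exact ih.step hs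

theorem RawStep.append {c c' : R.Node × List R.Box} {v : D} (h : RawStep c v c')
    (T : List R.Box) : RawStep (c.1, c.2 ++ T) v (c'.1, c'.2 ++ T) := by
  cases h with
  | internal S hd => exact .internal _ hd
  | call S hd => exact .call _ hd
  | ret S hd => exact .ret _ hd

/-- A step inspects at most the top box, so additional boxes at the bottom of the stack are carried
along. This fails to be meaningful for legal configurations without side conditions, hence the bare
pairs. -/
theorem RawComp.append {c c' : R.Node × List R.Box} {v : D} (h : RawComp c v c')
    (T : List R.Box) : RawComp (c.1, c.2 ++ T) v (c'.1, c'.2 ++ T) := by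
  induction h with
  | refl => exact .refl _
  | step _ hs ih => exact ih.step (hs.append T)

/-- A transition stays in its module, and the typing of call and return nodes matches the box pushed
or popped. Both directions matter: legality of the last stack of a computation is pulled back to the
first. -/
theorem RawStep.validStack_iff {c c' : R.Node × List R.Box} {v : D} (h : RawStep c v c') :
    R.ValidStack c.1.mod c.2 ↔ R.ValidStack c'.1.mod c'.2 := by
  cases h with
  | @internal u i S hd =>
    have h := R.delta_mod _ hd
    dsimp only at h ⊢
    rw [h]; rfl
  | @call u a S hd =>
    have h := R.delta_mod _ hd
    dsimp only at h ⊢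
    rw [h]
    exact ⟨fun hS => ⟨a.entry_mod.symm, hS⟩, fun hS => hS.2⟩
  | @ret u r S hd =>
    have h := R.delta_mod _ hd
    dsimp only at h ⊢
    rw [h]
    exact ⟨fun hS => hS.2, fun hS => ⟨r.exit_mod.symm, hS⟩⟩

theorem RawComp.validStack_iff {c c' : R.Node × List R.Box} {v : D} (h : RawComp c v c') :
    R.ValidStack c.1.mod c.2 ↔ R.ValidStack c'.1.mod c'.2 := by
  induction h with
  | refl => rfl
  | step _ hs ih => exact ih.trans hs.validStack_iff

theorem RawStep.step {c c' : R.Config} {v : D}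
    (h : RawStep (c.node, c.stack) v (c'.node, c'.stack)) : Step c v c' := by
  obtain ⟨u, S, hc⟩ := c
  obtain ⟨u', S', hc'⟩ := c'
  dsimp only at h
  cases h with
  | internal _ hd => exact .internal ⟨u, S, hc⟩ _ _ hd rfl rfl
  | call _ hd => exact .call ⟨u, S, hc⟩ _ _ hd rfl rfl
  | ret _ hd => exact .ret ⟨u, _, hc⟩ _ _ hd rfl rfl

theorem RawComp.computation {c c' : R.Node × List R.Box} {v : D} (h : RawComp c v c')
    (hc : R.ValidStack c.1.mod c.2) (hc' : R.ValidStack c'.1.mod c'.2) :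
    Computation ⟨c.1, c.2, hc⟩ v ⟨c'.1, c'.2, hc'⟩ := by
  induction h with
  | refl => exact .refl _
  | step hp hs ih =>
    have hv := (hs.validStack_iff).2 hc'
    exact (ih hv).step (RawStep.step (c := ⟨_, _, hv⟩) (c' := ⟨_, _, hc'⟩) hs)

/-! ### Runs -/

namespace Aut

variable {A : R.Aut}

theorem Run.append {q q' q'' : R.State} {S S' : List R.Box} {v v' : D} (h : A.Run q S v q')
    (h' : A.Run q' S' v' q'') : A.Run q (S ++ S') (v' * v) q'' := by
  induction h with
  | refl => simpa using h'
  | cons ht _ ih => rw [List.append_assoc, ← mul_assoc]; exact .cons ht (ih h')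

theorem Run.single (hA : A.IsConfigAut) {t : R.Trans} (ht : t ∈ A.trans) :
    A.Run t.src t.label.toList (A.wt t) t.tgt := by
  simpa using Run.cons ht (.refl t.tgt (hA.tgt_mem t ht))

theorem Run.weight_eq_one {q q' : R.State} {S : List R.Box} {v : D} (h1 : ∀ t ∈ A.trans, A.wt t = 1)
    (h : A.Run q S v q') : v = 1 := by
  induction h with
  | refl => rfl
  | cons ht _ ih => rw [ih, h1 _ ht, mul_one]

theorem Run.src_mem (hA : A.IsConfigAut) {q q' : R.State} {S : List R.Box} {v : D}
    (h : A.Run q S v q') : q ∈ A.Q := by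
  cases h with
  | refl _ hq => exact hq
  | cons ht _ => exact hA.src_mem _ ht

/-- The `ε`-transitions from an entry state are self-loops of weight one. -/
theorem IsConfigAut.eps_of_entry (hA : A.IsConfigAut) {t : R.Trans} (ht : t ∈ A.trans)
    (hl : t.label = none) (he : t.src.1.IsEntry) : t.tgt = t.src ∧ A.wt t = 1 := by
  have hwf := hA.wellFormed t ht
  obtain ⟨s, l, s'⟩ := t
  dsimp only at hl he ⊢
  subst hl
  obtain ⟨-, h | h⟩ := hwf
  · exact absurd he h.1
  · dsimp only at h; subst h
    exact ⟨rfl, hA.loop_wt _ (hA.src_mem _ ht) he⟩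

/-- A run from an entry state whose label starts with a box can be chosen to start with the
transition labelled by the box. -/
theorem Run.exists_box (hA : A.IsConfigAut) {q q' : R.State} {b : R.Box} {S : List R.Box} {v : D}
    (hq : q.1.IsEntry) (h : A.Run q (b :: S) v q') :
    ∃ p v', ⟨q, some b, p⟩ ∈ A.trans ∧ A.Run p S v' q' ∧ v = v' * A.wt ⟨q, some b, p⟩ := by
  generalize hL : b :: S = L at h
  induction h with
  | refl => exact absurd hL (by simp)
  | @cons t S' v' q' ht hr ih =>
    obtain ⟨s, l, s'⟩ := t
    cases l with
    | none =>
      obtain ⟨h1, h2⟩ := hA.eps_of_entry ht rfl hq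
      dsimp only at h1 hL
      subst h1
      obtain ⟨p, v'', hp⟩ := ih hq (by simpa using hL)
      exact ⟨p, v'', by rw [h2, mul_one]; exact hp⟩
    | some b' =>
      simp only [Option.toList_some, List.cons_append, List.nil_append, List.cons.injEq] at hL
      obtain ⟨rfl, rfl⟩ := hL
      exact ⟨s', v', ht, hr, rfl⟩

/-- An accepting run can be chosen to start with an `ε`-transition. -/
theorem Run.exists_eps (hA : A.IsConfigAut) {q q' : R.State} {S : List R.Box} {v : D}
    (hq' : q'.1.IsEntry) (h : A.Run q S v q') :
    ∃ p v', ⟨q, none, p⟩ ∈ A.trans ∧ A.Run p S v' q' ∧ v = v' * A.wt ⟨q, none, p⟩ := by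
  by_cases hq : q.1.IsEntry
  · have hQ := h.src_mem hA
    exact ⟨q, v, hA.loop_mem q hQ hq, h, by rw [hA.loop_wt q hQ hq, mul_one]⟩
  · cases h with
    | refl => exact absurd hq' hq
    | @cons t S v _ ht hr =>
      obtain ⟨s, l, s'⟩ := t
      cases l with
      | none => exact ⟨s', v, ht, hr, rfl⟩
      | some b => exact absurd (hA.wellFormed _ ht).1 hq

theorem IsConfigAut.tgt_isEntry (hA : A.IsConfigAut) {t : R.Trans} (ht : t ∈ A.trans) :
    t.tgt.1.IsEntry := by
  have hwf := hA.wellFormed t ht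
  obtain ⟨s, l, s'⟩ := t
  cases l with
  | none => exact hwf.1
  | some b => exact hwf.2.2.1

end Aut

end RSM

namespace ConfDist

open RSM

variable {D : Type u} [IdemSemiring D] {R : RSM.{u, v} D}

/-! ### The automaton built by the preprocessing -/

/-- The self-loop of the state `q`. -/
abbrev loop (q : R.State) : R.Trans := ⟨q, none, q⟩

open scoped Classical in
/-- The states after the preprocessing. -/
noncomputable def postStates (m : Mark) (A : R.Aut) : Finset R.State :=
  A.Q ∪ Finset.univ.image fun u => (u, m)

open scoped Classical in
/-- The initial states after the preprocessing. -/
noncomputable def postInit (m : Mark) (A : R.Aut) : Finset R.State :=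
  A.I ∪ Finset.univ.image fun u => (u, m)

/-- The transitions after the preprocessing. -/
inductive IsPostTrans (m : Mark) (A : R.Aut) : R.Trans → Prop
  | base {t} (h : t ∈ A.trans) : IsPostTrans m A t
  | loop {u : R.Node} (h : u.IsEntry) : IsPostTrans m A (loop (u, m))
  | box {u : R.Node} {c : R.Call} {q : R.State} (hc : (u, .call c) ∈ R.delta)
      (hq : q ∈ postStates m A) (he : q.1.IsEntry) (hm : q.1.mod = u.mod) :
      IsPostTrans m A ⟨(.entry c.entry, m), some c.box, q⟩
  | eps {u : R.Node} {q : R.State} (hu : ¬ u.IsEntry) (hq : q ∈ postStates m A)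
      (he : q.1.IsEntry) (hm : u.mod = q.1.mod) : IsPostTrans m A ⟨(u, m), none, q⟩

/-- The transitions that the main loop may process. -/
def Active (m : Mark) (A : R.Aut) (t : R.Trans) : Prop :=
  (t.label = none ∧ t.src ∈ postInit m A) ∨ (t.label ≠ none ∧ t.src.2 = m)

variable {m : Mark} {A : R.Aut}

theorem mem_postStates {q : R.State} : q ∈ postStates m A ↔ q ∈ A.Q ∨ q.2 = m := by
  obtain ⟨u, a⟩ := q
  simp [postStates, eq_comm]

theorem mem_postInit {q : R.State} : q ∈ postInit m A ↔ q ∈ A.I ∨ q.2 = m := by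
  obtain ⟨u, a⟩ := q
  simp [postInit, eq_comm]

theorem snd_ne_of_mem (hm : m ∉ A.marks) {q : R.State} (hq : q ∈ A.Q) : q.2 ≠ m := by
  rintro rfl
  exact hm (Finset.mem_image_of_mem _ hq)

theorem Active.of_snd {t : R.Trans} (h : t.src.2 = m) : Active m A t := by
  by_cases hl : t.label = none
  · exact Or.inl ⟨hl, mem_postInit.2 (Or.inr h)⟩
  · exact Or.inr ⟨hl, h⟩

theorem IsPostTrans.src_mem (hA : A.IsConfigAut) {t : R.Trans} (h : IsPostTrans m A t) :
    t.src ∈ postStates m A := by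
  cases h with
  | base h => exact mem_postStates.2 (Or.inl (hA.src_mem _ h))
  | loop | box | eps => exact mem_postStates.2 (Or.inr rfl)

theorem IsPostTrans.tgt_mem (hA : A.IsConfigAut) {t : R.Trans} (h : IsPostTrans m A t) :
    t.tgt ∈ postStates m A := by
  cases h with
  | base h => exact mem_postStates.2 (Or.inl (hA.tgt_mem _ h))
  | loop => exact mem_postStates.2 (Or.inr rfl)
  | box _ hq | eps _ hq => exact hq

theorem IsPostTrans.wellFormed (hA : A.IsConfigAut) {t : R.Trans} (h : IsPostTrans m A t) :
    t.WellFormed := by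
  cases h with
  | base h => exact hA.wellFormed _ h
  | loop h => exact ⟨h, Or.inr rfl⟩
  | @box u c q hc hq he hm => exact ⟨trivial, c.entry_mod, he, hm.trans (R.delta_mod _ hc)⟩
  | eps hu hq he hm => exact ⟨he, Or.inl ⟨hu, hm⟩⟩

theorem IsPostTrans.mem_of_snd_ne {t : R.Trans} (h : IsPostTrans m A t) (ht : t.src.2 ≠ m) :
    t ∈ A.trans := by
  cases h with
  | base h => exact h
  | loop | box | eps => exact absurd rfl ht

theorem IsPostTrans.tgt_isEntry (hA : A.IsConfigAut) {t : R.Trans} (h : IsPostTrans m A t) :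
    t.tgt.1.IsEntry := by
  have hwf := h.wellFormed hA
  obtain ⟨s, l, s'⟩ := t
  cases l with
  | none => exact hwf.1
  | some b => exact hwf.2.2.1

theorem IsPostTrans.mod_eq (hA : A.IsConfigAut) {t : R.Trans} (h : IsPostTrans m A t)
    (hl : t.label = none) : t.src.1.mod = t.tgt.1.mod := by
  have hwf := h.wellFormed hA
  obtain ⟨s, l, s'⟩ := t
  dsimp only at hl; subst hl
  obtain ⟨-, h | h⟩ := hwf
  exacts [h.2, by dsimp only at h ⊢; rw [h]]

theorem IsPostTrans.box_mod (hA : A.IsConfigAut) {t : R.Trans} (h : IsPostTrans m A t)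
    {b : R.Box} (hl : t.label = some b) :
    t.src.1.IsEntry ∧ t.src.1.mod = R.Y b ∧ t.tgt.1.mod = R.boxMod b := by
  have hwf := h.wellFormed hA
  obtain ⟨s, l, s'⟩ := t
  dsimp only at hl; subst hl
  exact ⟨hwf.1, hwf.2.1, hwf.2.2.2⟩

theorem IsPostTrans.int (hA : A.IsConfigAut) {t : R.Trans} (h : IsPostTrans m A t)
    (hl : t.label = none) {i : R.Int} (hi : (t.src.1, .int i) ∈ R.delta) :
    IsPostTrans m A ⟨(.int i, m), none, t.tgt⟩ :=
  .eps id (h.tgt_mem hA) (h.tgt_isEntry hA)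
    ((R.delta_mod _ hi).symm.trans (h.mod_eq hA hl))

theorem IsPostTrans.call (hA : A.IsConfigAut) {t : R.Trans} (h : IsPostTrans m A t)
    (hl : t.label = none) {c : R.Call} (hc : (t.src.1, .call c) ∈ R.delta) :
    IsPostTrans m A ⟨(.entry c.entry, m), some c.box, t.tgt⟩ :=
  .box hc (h.tgt_mem hA) (h.tgt_isEntry hA) (h.mod_eq hA hl).symm

theorem IsPostTrans.ret (hA : A.IsConfigAut) {t : R.Trans} (h : IsPostTrans m A t) {r : R.Ret}
    (hl : t.label = some r.box) : IsPostTrans m A ⟨(.ret r, m), none, t.tgt⟩ :=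
  .eps id (h.tgt_mem hA) (h.tgt_isEntry hA) (h.box_mod hA hl).2.2.symm

/-! ### The meaning of the weights -/

/-- The pairs of a node and a stack from which the computations summarized by the transitions into
the state `q` start. -/
def origins (m : Mark) (A : R.Aut) (q : R.State) : Set (R.Node × List R.Box) :=
  {c | (q.2 = m ∧ c = (q.1, [])) ∨
    (q.2 ≠ m ∧ ∃ a, (c.1, a) ∈ A.I ∧ ∃ v, A.Run (c.1, a) c.2 v q)}

variable [WellFoundedGT D]

/-- The value that the weight of the transition `t` approximates. -/
noncomputable def wtBound (m : Mark) (A : R.Aut) (t : R.Trans) : D :=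
  combine {v | ∃ c ∈ origins m A t.tgt, RawComp c v (t.src.1, t.label.toList)}

/-- The value that the summary `sum (q, x)` approximates. -/
noncomputable def sumBound (m : Mark) (A : R.Aut) (q : R.State) (x : R.Exit) : D :=
  combine {v | ∃ c ∈ origins m A q, ∃ u, (u, .exit x) ∈ R.delta ∧ RawComp c v (u, [])}

/-- Every summarized computation is prolonged by one step with the same origin. The call case below
is analogous; the exit case passes the same computations on to the summary, as exits have weight
one. -/
theorem wtBound_mul_int_le {t : R.Trans} (hl : t.label = none) {i : R.Int}
    (hi : (t.src.1, .int i) ∈ R.delta) :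
    wtBound m A t * R.w (t.src.1, .int i) ≤ wtBound m A ⟨(.int i, m), none, t.tgt⟩ := by
  refine combine_mul_le ?_
  rintro v ⟨c, hc, h⟩
  rw [hl] at h
  exact le_combine ⟨c, hc, h.step (.internal _ hi)⟩

theorem wtBound_mul_call_le {t : R.Trans} (hl : t.label = none) {a : R.Call}
    (ha : (t.src.1, .call a) ∈ R.delta) :
    wtBound m A t * R.w (t.src.1, .call a) ≤
      wtBound m A ⟨(.entry a.entry, m), some a.box, t.tgt⟩ := by
  refine combine_mul_le ?_
  rintro v ⟨c, hc, h⟩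
  rw [hl] at h
  exact le_combine ⟨c, hc, h.step (.call _ ha)⟩

theorem wtBound_le_sumBound {t : R.Trans} (hl : t.label = none) {x : R.Exit}
    (hx : (t.src.1, .exit x) ∈ R.delta) : wtBound m A t ≤ sumBound m A t.tgt x := by
  refine combine_le ?_
  rintro v ⟨c, hc, h⟩
  rw [hl] at h
  exact le_combine ⟨c, hc, _, hx, h⟩

/-- The node and the label of the transition form an origin of its target by the one-transition run,
and the empty computation from there has weight one. -/
theorem one_le_wtBound_of_init (hA : A.IsConfigAut) (hm : m ∉ A.marks) {t : R.Trans}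
    (ht : t ∈ A.trans) (hI : t.src ∈ A.I) : 1 ≤ wtBound m A t := by
  refine le_combine ⟨(t.src.1, t.label.toList), Or.inr ⟨snd_ne_of_mem hm (hA.tgt_mem t ht), t.src.2,
    hI, _, Aut.Run.single hA ht⟩, .refl _⟩

theorem one_le_wtBound_loop (u : R.Node) : 1 ≤ wtBound m A (loop (u, m)) :=
  le_combine ⟨(u, []), Or.inl ⟨rfl, rfl⟩, .refl _⟩

/-- The return rule. For a new source, a computation up to the call is followed by one inside the
called module. For an old source, the call belongs to the stack read by `A`: the origin of the
summary is enlarged by the box, and the factor is one. -/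
theorem mul_sumBound_le (hA : A.IsConfigAut) (hm : m ∉ A.marks) {t : R.Trans} {r : R.Ret} {d : D}
    (ht : IsPostTrans m A t) (hl : t.label = some r.box) (hd : t.src.2 = m → d ≤ wtBound m A t)
    (hd' : t.src.2 ≠ m → d = 1) :
    d * sumBound m A t.src r.exit ≤ wtBound m A ⟨(.ret r, m), none, t.tgt⟩ := by
  -- The computation inside the callee runs above the box, which the final return of weight one
  -- pops.
  have key : ∀ {c c' : R.Node × List R.Box} {v w : D} {u : R.Node}, (u, .exit r.exit) ∈ R.delta →
      RawComp c v (c'.1, c'.2 ++ [r.box]) → RawComp c' w (u, []) →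
      RawComp c (v * w) (.ret r, []) := by
    intro c c' v w u hu h h'
    have := (h.trans (h'.append [r.box])).step (.ret [] hu)
    rwa [R.w_exit _ _ hu, mul_one] at this
  by_cases hs : t.src.2 = m
  · refine (mul_le_mul_left (hd hs) _).trans (combine_mul_combine_le ?_)
    rintro v ⟨c, hc, h⟩ w ⟨c', (⟨-, rfl⟩ | ⟨h', -⟩), u, hu, hw⟩
    · rw [hl] at h
      exact le_combine ⟨c, hc, key (c' := (t.src.1, [])) hu h hw⟩
    · exact absurd hs h'
  · rw [hd' hs]
    refine mul_combine_le ?_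
    have htA := ht.mem_of_snd_ne hs
    rintro w ⟨c', (⟨h', -⟩ | ⟨-, a, ha, v, hv⟩), u, hu, hw⟩
    · exact absurd h' hs
    · have hr := hv.append (Aut.Run.single hA htA)
      rw [hl] at hr
      exact le_combine ⟨(c'.1, c'.2 ++ [r.box]),
        Or.inr ⟨snd_ne_of_mem hm (hA.tgt_mem t htA), a, ha, _, hr⟩,
        key (c' := c') hu (.refl _) hw⟩

end ConfDist

namespace ConfDist

open RSM Prog

variable {D : Type u} [IdemSemiring D] {R : RSM.{u, v} D}

/-! ### The potential -/

open scoped Classical in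
/-- The entries of the module `i`. -/
noncomputable def entriesOf (R : RSM.{u, v} D) (i : R.Mod) : Finset R.Entry :=
  Finset.univ.filter fun e => R.entryMod e = i

open scoped Classical in
/-- The return nodes of the box `b`. -/
noncomputable def retsOf (R : RSM.{u, v} D) (b : R.Box) : Finset R.Ret :=
  Finset.univ.filter fun r => r.box = b

open scoped Classical in
/-- The return nodes of the exit `x`. -/
noncomputable def retsAt (R : RSM.{u, v} D) (x : R.Exit) : Finset R.Ret :=
  Finset.univ.filter fun r => r.exit = x

open scoped Classical in
/-- The marks after the preprocessing. -/
noncomputable def postMarks (m : Mark) (A : R.Aut) : Finset Mark := insert m A.marks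

theorem mem_intsFrom {u : R.Node} {i : R.Int} : i ∈ intsFrom u ↔ (u, .int i) ∈ R.delta := by
  simp [intsFrom]

theorem mem_callsFrom {u : R.Node} {c : R.Call} : c ∈ callsFrom u ↔ (u, .call c) ∈ R.delta := by
  simp [callsFrom]

theorem mem_exitsFrom {u : R.Node} {x : R.Exit} : x ∈ exitsFrom u ↔ (u, .exit x) ∈ R.delta := by
  simp [exitsFrom]

theorem mem_retsOf {b : R.Box} {r : R.Ret} : r ∈ retsOf R b ↔ r.box = b := by
  simp [retsOf]

/-- The number of transitions of `R` from the node `u`. -/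
noncomputable def outDegree (u : R.Node) : ℕ :=
  (intsFrom u).card + (callsFrom u).card + (exitsFrom u).card

/-- A bound for the cost of processing a transition. -/
noncomputable def transCost (t : R.Trans) : ℕ :=
  match t.label with
  | none => 5 * (outDegree t.src.1 + 1)
  | some b => 5 * ((retsOf R b).card + 1)

/-- A bound for the cost of the loop that follows an update of a summary at the exit `x`. -/
noncomputable def sumCost (m : Mark) (A : R.Aut) (x : R.Exit) : ℕ :=
  4 * ((retsAt R x).card * (R.entryBound * (postMarks m A).card)) + 2

open scoped Classical in
/-- A finite set that contains the `ε`-transitions. -/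
noncomputable def epsTrans (m : Mark) (A : R.Aut) : Finset R.Trans :=
  ((Finset.univ : Finset R.Node).sigma fun u =>
    entriesOf R u.mod ×ˢ (postMarks m A ×ˢ postMarks m A)).image
      fun p => ⟨(p.1, p.2.2.1), none, (.entry p.2.1, p.2.2.2)⟩

open scoped Classical in
/-- A finite set that contains the transitions labelled by boxes. -/
noncomputable def boxTrans (m : Mark) (A : R.Aut) : Finset R.Trans :=
  ((Finset.univ : Finset R.Call).sigma fun c =>
    entriesOf R (R.boxMod c.box) ×ˢ (postMarks m A ×ˢ postMarks m A)).image
      fun p => ⟨(.entry p.1.entry, p.2.2.1), some p.1.box, (.entry p.2.1, p.2.2.2)⟩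

open scoped Classical in
noncomputable def allTrans (m : Mark) (A : R.Aut) : Finset R.Trans := epsTrans m A ∪ boxTrans m A

open scoped Classical in
/-- A finite set that contains the arguments of the summary function. -/
noncomputable def allSums (m : Mark) (A : R.Aut) : Finset (R.State × R.Exit) :=
  ((Finset.univ : Finset R.Exit).sigma fun x => entriesOf R (R.exitMod x) ×ˢ postMarks m A).image
    fun p => ((.entry p.2.1, p.2.2), p.1)

open scoped Classical in
/-- The potential of a memory pays for the remaining iterations of the main loop. -/
noncomputable def potential (m : Mark) (A : R.Aut) (s : Mem R) : ℕ :=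
  ∑ t ∈ allTrans m A, transCost t * (chainRank (s.aut.wt t) + if t ∈ s.WL then 1 else 0) +
    ∑ p ∈ allSums m A, sumCost m A p.2 * chainRank (s.sum p.1 p.2)

variable {m : Mark} {A : R.Aut}

theorem mem_postMarks {q : R.State} (hq : q ∈ postStates m A) : q.2 ∈ postMarks m A := by
  rcases mem_postStates.1 hq with h | h
  · exact Finset.mem_insert_of_mem (Finset.mem_image_of_mem _ h)
  · exact h ▸ Finset.mem_insert_self _ _

theorem exists_entry {q : R.State} (hq : q.1.IsEntry) :
    ∃ e a, q = (RSMFrame.Node.entry e, a) := by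
  obtain ⟨u, a⟩ := q
  cases u with
  | entry e => exact ⟨e, a, rfl⟩
  | int | ret => exact hq.elim

theorem IsPostTrans.mem_allTrans (hA : A.IsConfigAut) {t : R.Trans} (h : IsPostTrans m A t) :
    t ∈ allTrans m A := by
  classical
  have hs := mem_postMarks (h.src_mem hA)
  have ht := mem_postMarks (h.tgt_mem hA)
  obtain ⟨e, b, he⟩ := exists_entry (h.tgt_isEntry hA)
  obtain ⟨⟨u, a⟩, l, q⟩ := t
  dsimp only at he hs ht
  subst he
  cases l with
  | none =>
    have hmod := h.mod_eq hA rfl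
    refine Finset.mem_union_left _ (Finset.mem_image.2 ⟨⟨u, e, a, b⟩, ?_, rfl⟩)
    simp only [Finset.mem_sigma, Finset.mem_univ, true_and, Finset.mem_product, entriesOf,
      Finset.mem_filter]
    exact ⟨hmod.symm, hs, ht⟩
  | some x =>
    obtain ⟨h1, h2, h3⟩ := h.box_mod hA rfl
    obtain ⟨e', a', he'⟩ := exists_entry h1
    simp only [Prod.mk.injEq] at he'
    obtain ⟨rfl, rfl⟩ := he'
    refine Finset.mem_union_right _ (Finset.mem_image.2 ⟨⟨⟨x, e', h2⟩, e, a, b⟩, ?_, rfl⟩)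
    simp only [Finset.mem_sigma, Finset.mem_univ, true_and, Finset.mem_product, entriesOf,
      Finset.mem_filter]
    exact ⟨h3, hs, ht⟩

theorem mem_allSums {q : R.State} {x : R.Exit} (hq : q ∈ postStates m A) (he : q.1.IsEntry)
    (hx : R.exitMod x = q.1.mod) : (q, x) ∈ allSums m A := by
  classical
  have hs := mem_postMarks hq
  obtain ⟨e, b, rfl⟩ := exists_entry he
  refine Finset.mem_image.2 ⟨⟨x, e, b⟩, ?_, rfl⟩
  simp only [Finset.mem_sigma, Finset.mem_univ, true_and, Finset.mem_product, entriesOf,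
    Finset.mem_filter]
  exact ⟨hx.symm, hs⟩

theorem card_entriesOf_le (i : R.Mod) : (entriesOf R i).card ≤ R.entryBound :=
  Finset.le_sup (f := fun i => (entriesOf R i).card) (Finset.mem_univ i)

theorem sum_add_le_sum_of_release {α : Type*} {T : Finset α} {f g : α → ℕ} {a : α} {c : ℕ}
    (ha : a ∈ T) (h : ∀ b ∈ T, f b ≤ g b) (hc : f a + c ≤ g a) :
    ∑ b ∈ T, f b + c ≤ ∑ b ∈ T, g b := by
  classical
  rw [← Finset.add_sum_erase _ _ ha, ← Finset.add_sum_erase _ _ ha]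
  have := Finset.sum_le_sum fun b (hb : b ∈ T.erase a) => h b (Finset.mem_of_mem_erase hb)
  omega

/-- Extraction frees one unit of the worklist indicator of `t`, which pays for processing it. Only
membership in the new worklist `E` is used. -/
theorem potential_erase {s : Mem R} {t : R.Trans} (ht : t ∈ s.WL) (ht' : t ∈ allTrans m A)
    (E : Finset R.Trans) (hE : ∀ t', t' ∈ E ↔ t' ≠ t ∧ t' ∈ s.WL) :
    potential m A { s with WL := E } + transCost t ≤ potential m A s := by
  classical
  unfold potential
  rw [add_right_comm]
  refine Nat.add_le_add_right (sum_add_le_sum_of_release ht' (fun b _ => ?_) ?_) _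
  · refine Nat.mul_le_mul_left _ (Nat.add_le_add_left ?_ _)
    dsimp only
    split_ifs with h1 h2
    · exact le_rfl
    · exact absurd ((hE b).1 h1).2 h2
    · exact Nat.zero_le _
    · exact le_rfl
  · have : t ∉ E := fun h => ((hE t).1 h).1 rfl
    simp only [this, ht, if_false, if_true]
    rw [Nat.add_zero, mul_add, mul_one]

/-- A raised summary drops in rank by at least one and so frees the cost of the return loop that
follows. -/
theorem potential_setSum {H : ℕ} (hH : HasHeight D H) {s : Mem R} {q : R.State} {x : R.Exit} {d : D}
    (hq : (q, x) ∈ allSums m A) (hd : s.sum q x < d) :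
    potential m A (setSum q x d s) + sumCost m A x ≤ potential m A s := by
  classical
  unfold potential
  rw [add_assoc]
  refine Nat.add_le_add_left (sum_add_le_sum_of_release hq (fun b _ => ?_) ?_) _
  · refine Nat.mul_le_mul_left _ ?_
    by_cases hb : b.1 = q
    · by_cases hb' : b.2 = x
      · simpa [setSum, hb, hb'] using (hH.chainRank_lt hd).le
      · simp [setSum, hb, hb']
    · simp [setSum, hb]
  · have := hH.chainRank_lt hd
    simp only [setSum, Function.update_self]
    calc _ = sumCost m A x * (chainRank d + 1) := by rw [mul_add, mul_one]
      _ ≤ _ := Nat.mul_le_mul_left _ this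

/-- The drop of the rank by at least one offsets the worklist indicator, which rises by at most one.
-/
theorem potential_relax {H : ℕ} (hH : HasHeight D H) {s : Mem R} {t : R.Trans} {d : D}
    (hd : s.aut.wt t < d) :
    potential m A (addWL t (setWt t d s)) ≤ potential m A s := by
  classical
  unfold potential
  refine Nat.add_le_add_right (Finset.sum_le_sum fun b _ => Nat.mul_le_mul_left _ ?_) _
  by_cases hb : b = t
  · subst hb
    have := hH.chainRank_lt hd
    simp only [addWL, setWt, Function.update_self, Finset.mem_insert_self, if_true]
    omega
  · simp [addWL, setWt, hb]

/-! ### The invariant of the main loop -/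

/-- What the main loop has to achieve for a transition of the automaton and a transition of `R`. -/
inductive Goal (R : RSM.{u, v} D)
  | int (t : R.Trans) (i : R.Int)
  | call (t : R.Trans) (c : R.Call)
  | exit (t : R.Trans) (x : R.Exit)
  | box (t : R.Trans) (r : R.Ret)

namespace Goal

/-- The transition of the automaton that a goal is about. -/
def trans : Goal R → R.Trans
  | int t _ | call t _ | exit t _ | box t _ => t

/-- The transition of the automaton that a goal is about may be processed. -/
def Valid (m : Mark) (A : R.Aut) : Goal R → Prop
  | int t i => IsPostTrans m A t ∧ t.label = none ∧ t.src ∈ postInit m A ∧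
      (t.src.1, .int i) ∈ R.delta
  | call t c => IsPostTrans m A t ∧ t.label = none ∧ t.src ∈ postInit m A ∧
      (t.src.1, .call c) ∈ R.delta
  | exit t x => IsPostTrans m A t ∧ t.label = none ∧ t.src ∈ postInit m A ∧
      (t.src.1, .exit x) ∈ R.delta
  | box t r => IsPostTrans m A t ∧ t.label = some r.box

/-- The inequality that a goal asks for. -/
def Closed (m : Mark) (s : Mem R) : Goal R → Prop
  | int t i => s.aut.wt t * R.w (t.src.1, .int i) ≤ s.aut.wt ⟨(.int i, m), none, t.tgt⟩
  | call t c =>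
      s.aut.wt t * R.w (t.src.1, .call c) ≤ s.aut.wt ⟨(.entry c.entry, m), some c.box, t.tgt⟩
  | exit t x => s.aut.wt t ≤ s.sum t.tgt x
  | box t r => s.aut.wt t * s.sum t.src r.exit ≤ s.aut.wt ⟨(.ret r, m), none, t.tgt⟩

/-- A goal is met if its inequality holds or will be restored by the processing of a transition in
the worklist. -/
def Met (m : Mark) (s : Mem R) (g : Goal R) : Prop := g.trans ∈ s.WL ∨ g.Closed m s

/-- Each inequality has on its left the weight of the goal's own transition, which can change only
if that transition is in the worklist. Other weights occur on the right, where growth does no harm.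
Summaries occur on both sides and must stay fixed. -/
theorem Met.mono {s s' : Mem R} {g : Goal R} (h : g.Met m s) (hWL : s.WL ⊆ s'.WL)
    (hwt : ∀ t, s.aut.wt t ≤ s'.aut.wt t) (heq : ∀ t, t ∉ s'.WL → s'.aut.wt t = s.aut.wt t)
    (hsum : s'.sum = s.sum) : g.Met m s' := by
  by_cases ht : g.trans ∈ s'.WL
  · exact Or.inl ht
  refine Or.inr ?_
  have hc := h.resolve_left fun h => ht (hWL h)
  cases g with
  | int t i => simpa only [Closed, heq t ht] using le_trans hc (hwt _)
  | call t c => simpa only [Closed, heq t ht] using le_trans hc (hwt _)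
  | exit t x => simpa only [Closed, heq t ht, hsum] using hc
  | box t r => simpa only [Closed, heq t ht, hsum] using le_trans hc (hwt _)

end Goal

variable [WellFoundedGT D]

/-- The part of the invariant that holds at all times after the preprocessing and the
initialization. -/
structure Base (m : Mark) (A : R.Aut) (s : Mem R) : Prop where
  states : s.aut.Q = postStates m A
  trans : ∀ t, t ∈ s.aut.trans ↔ IsPostTrans m A t
  init : s.aut.I = postInit m A
  final : s.aut.F = A.F
  wt_base : ∀ t ∈ A.trans, s.aut.wt t = 1
  wt_loop : ∀ u : R.Node, u.IsEntry → s.aut.wt (loop (u, m)) = 1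
  wl : ∀ t ∈ s.WL, IsPostTrans m A t ∧ Active m A t
  added : ∀ u : R.Node, u.IsEntry → loop (u, m) ∈ s.added
  wt_le : ∀ t, IsPostTrans m A t → Active m A t → s.aut.wt t ≤ wtBound m A t
  sum_le : ∀ q x, s.sum q x ≤ sumBound m A q x

/-- The invariant of the main loop, with the goals in `X` met. -/
def Inv (m : Mark) (A : R.Aut) (X : Set (Goal R)) (s : Mem R) : Prop :=
  Base m A s ∧ ∀ g ∈ X, g.Valid m A → g.Met m s

theorem Inv.anti {X Y : Set (Goal R)} {s : Mem R} (h : Inv m A X s)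
    (hXY : ∀ g ∈ Y, g.Valid m A → g ∈ X) : Inv m A Y s :=
  ⟨h.1, fun g hg hv => h.2 g (hXY g hg hv) hv⟩

/-- The conditions on the source and the label keep `t` distinct from the transitions of `A` and
from the self-loops, whose weights must stay one. The hypothesis `hg` records how a sufficiently
large new weight of `t` meets the goal `g`. -/
theorem hoare_relax {H : ℕ} (hH : HasHeight D H) (hm : m ∉ A.marks) (hA : A.IsConfigAut)
    {t : R.Trans} {d : Mem R → D} {Y : Set (Goal R)} (g : Goal R) (ht : IsPostTrans m A t)
    (hsnd : t.src.2 = m) (hloop : t.label = none → ¬ t.src.1.IsEntry)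
    (hd : ∀ s, Base m A s → d s ≤ wtBound m A t)
    (hg : ∀ s s' : Mem R, (∀ t', t' ∉ s'.WL → s'.aut.wt t' = s.aut.wt t') → s'.sum = s.sum →
      d s ≤ s'.aut.wt t → g.Met m s') :
    Hoare (potential m A) (Inv m A Y) (relax t d) 3 (Inv m A (Y ∪ {g})) := by
  classical
  intro s hs r hr
  refine Hoare.when (P := fun s' => s' = s) (c := 2)
    (Q := Inv m A (Y ∪ {g})) (Φ := potential m A) ?_ ?_ s rfl r hr
  · rintro s' ⟨rfl, hlt⟩ _ ⟨r₁, hr₁, r₂, hr₂, rfl⟩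
    obtain rfl : r₁ = _ := hr₁
    obtain rfl : r₂ = _ := hr₂
    have hlt' : s'.aut.wt t < s'.aut.wt t + d s' :=
      lt_of_le_of_ne (by rw [add_eq_sup]; exact le_sup_left) hlt
    refine ⟨⟨?_, ?_⟩, ?_⟩
    · have hB := hs.1
      have hne : ∀ t', t' ≠ t → (addWL t (setWt t (s'.aut.wt t + d s') s')).aut.wt t' =
          s'.aut.wt t' := fun t' h => by simp [addWL, setWt, h]
      refine ⟨hB.states, hB.trans, hB.init, hB.final, fun t' ht' => ?_, fun u hu => ?_,
        fun t' ht' => ?_, fun u hu => Finset.mem_insert_of_mem (hB.added u hu),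
        fun t' ht' ha => ?_, hB.sum_le⟩
      · exact (hne t' fun h => snd_ne_of_mem hm (hA.src_mem _ ht') (h ▸ hsnd)).trans
          (hB.wt_base t' ht')
      · refine (hne _ fun h => ?_).trans (hB.wt_loop u hu)
        subst h
        exact hloop rfl hu
      · rcases Finset.mem_insert.1 ht' with rfl | h
        · exact ⟨ht, .of_snd hsnd⟩
        · exact hB.wl t' h
      · by_cases h : t' = t
        · subst h
          simp only [addWL, setWt, Function.update_self]
          rw [add_eq_sup]
          exact sup_le (hB.wt_le _ ht' ha) (hd _ hB)
        · rw [hne t' h]; exact hB.wt_le _ ht' ha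
    · have hoff : ∀ t', t' ∉ (addWL t (setWt t (s'.aut.wt t + d s') s')).WL →
          (addWL t (setWt t (s'.aut.wt t + d s') s')).aut.wt t' = s'.aut.wt t' := by
        intro t' h
        have : t' ≠ t := fun h' => h (h' ▸ Finset.mem_insert_self _ _)
        simp [addWL, setWt, this]
      rintro g' (hg' | rfl) hv
      · refine (hs.2 g' hg' hv).mono (Finset.subset_insert _ _) (fun t' => ?_) hoff rfl
        by_cases h : t' = t
        · subst h
          simp [addWL, setWt]
        · simp [addWL, setWt, h]
      · refine hg s' _ hoff rfl ?_
        simp only [addWL, setWt, Function.update_self]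
        rw [add_eq_sup]; exact le_sup_right
    · have := potential_relax (m := m) (A := A) hH hlt'
      dsimp only
      omega
  · rintro s' rfl hlt
    have heq : s'.aut.wt t + d s' = s'.aut.wt t := (not_not.1 hlt).symm
    refine ⟨hs.1, ?_⟩
    rintro g' (hg' | rfl) hv
    · exact hs.2 g' hg' hv
    · refine hg s' s' (fun _ _ => rfl) rfl ?_
      rw [← heq, add_eq_sup]; exact le_sup_right

end ConfDist

namespace ConfDist

open RSM Prog

variable {D : Type u} [IdemSemiring D] {R : RSM.{u, v} D} {m : Mark} {A : R.Aut}
  [WellFoundedGT D]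

/-! ### One iteration of the main loop -/

open scoped Classical in
/-- The pairs of a return node and a state that the inner loop for the state `q` and the exit `x`
runs over. -/
noncomputable def returnPairs (m : Mark) (A : R.Aut) (q : R.State) (x : R.Exit) :
    Finset (R.Ret × R.State) :=
  (Finset.univ ×ˢ postStates m A).filter fun p =>
    p.1.exit = x ∧ IsPostTrans m A ⟨q, some p.1.box, p.2⟩

omit [WellFoundedGT D] in
theorem card_returnPairs_le (hA : A.IsConfigAut) (q : R.State) (x : R.Exit) :
    (returnPairs m A q x).card ≤
      (retsAt R x).card * (R.entryBound * (postMarks m A).card) := by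
  classical
  have hsub : returnPairs m A q x ⊆ (retsAt R x).biUnion fun r =>
      (entriesOf R (R.boxMod r.box) ×ˢ postMarks m A).image fun p => (r, (.entry p.1, p.2)) := by
    rintro ⟨r, q'⟩ hp
    simp only [returnPairs, Finset.mem_filter, Finset.mem_product, Finset.mem_univ, true_and] at hp
    obtain ⟨hq', hx, ht⟩ := hp
    obtain ⟨e, a, rfl⟩ := exists_entry (ht.tgt_isEntry hA)
    refine Finset.mem_biUnion.2 ⟨r, by simpa [retsAt] using hx,
      Finset.mem_image.2 ⟨(e, a), Finset.mem_product.2 ⟨?_, mem_postMarks hq'⟩, rfl⟩⟩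
    exact Finset.mem_filter.2 ⟨Finset.mem_univ _, (ht.box_mod hA rfl).2.2⟩
  refine (Finset.card_le_card hsub).trans (Finset.card_biUnion_le_card_mul _ _ _ fun r _ => ?_)
  refine Finset.card_image_le.trans ?_
  rw [Finset.card_product]
  exact Nat.mul_le_mul_right _ (card_entriesOf_le _)

theorem Base.mul_sum_le (hA : A.IsConfigAut) (hm : m ∉ A.marks) {s : Mem R} (h : Base m A s)
    {t : R.Trans} {r : R.Ret} (ht : IsPostTrans m A t) (hl : t.label = some r.box) :
    s.aut.wt t * s.sum t.src r.exit ≤ wtBound m A ⟨(.ret r, m), none, t.tgt⟩ :=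
  (mul_le_mul_right (h.sum_le _ _) _).trans
    (mul_sumBound_le hA hm ht hl (fun hs => h.wt_le t ht (.of_snd hs))
      fun hs => h.wt_base t (ht.mem_of_snd_ne hs))

variable {H : ℕ}

theorem hoare_intLoop (hH : HasHeight D H) (hm : m ∉ A.marks) (hA : A.IsConfigAut) {t : R.Trans}
    (ht : IsPostTrans m A t) (ha : Active m A t) (hl : t.label = none) {Y : Set (Goal R)} :
    Hoare (potential m A) (Inv m A Y)
      (.forEach (fun _ => intsFrom t.src.1) fun i =>
        relax ⟨(.int i, m), none, t.tgt⟩ (fun s => s.aut.wt t * R.w (t.src.1, .int i)))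
      (4 * (intsFrom t.src.1).card + 1) (Inv m A (Y ∪ ⋃ i ∈ intsFrom t.src.1, {.int t i})) := by
  refine (Hoare.forEach (k := fun _ => 3) (fun i => {Goal.int t i}) (fun _ _ => rfl)
    fun i hi Y _ => ?_).weaken (fun _ h => h) (fun _ h => h) (by simp [mul_comm])
  have hi' : (t.src.1, .int i) ∈ R.delta := mem_intsFrom.1 hi
  refine hoare_relax hH hm hA _ (ht.int hA hl hi') rfl (fun _ => id) (fun s hs => ?_)
    fun s s' hwt hsum hd => ?_
  · exact (mul_le_mul_left (hs.wt_le t ht ha) _).trans (wtBound_mul_int_le hl hi')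
  -- The relaxed transition may be `t` itself, which then returns to the worklist. Otherwise its
  -- weight is still the one used in the relaxation.
  · by_cases h : t ∈ s'.WL
    · exact Or.inl h
    · refine Or.inr ?_
      dsimp only [Goal.Closed]
      rwa [hwt t h]

theorem hoare_callLoop (hH : HasHeight D H) (hm : m ∉ A.marks) (hA : A.IsConfigAut) {t : R.Trans}
    (ht : IsPostTrans m A t) (ha : Active m A t) (hl : t.label = none) {Y : Set (Goal R)} :
    Hoare (potential m A) (Inv m A Y)
      (.forEach (fun _ => callsFrom t.src.1) fun c =>
        relax ⟨(.entry c.entry, m), some c.box, t.tgt⟩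
          (fun s => s.aut.wt t * R.w (t.src.1, .call c)) ;;
        .when (fun s => ⟨(.entry c.entry, m), none, (.entry c.entry, m)⟩ ∉ s.added)
          (.act (addWL ⟨(.entry c.entry, m), none, (.entry c.entry, m)⟩)))
      (5 * (callsFrom t.src.1).card + 1) (Inv m A (Y ∪ ⋃ c ∈ callsFrom t.src.1, {.call t c})) := by
  refine (Hoare.forEach (k := fun _ => 3 + (0 + 1)) (fun c => {Goal.call t c}) (fun _ _ => rfl)
    fun c hc Y _ => ?_).weaken (fun _ h => h) (fun _ h => h) (by simp [mul_comm])
  have hc' : (t.src.1, .call c) ∈ R.delta := mem_callsFrom.1 hc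
  refine Hoare.seq (M := Inv m A (Y ∪ {Goal.call t c})) ?_ (Hoare.when ?_ fun s hs _ => hs)
  · refine hoare_relax hH hm hA _ (ht.call hA hl hc') rfl (fun h => by cases h) (fun s hs => ?_)
      fun s s' hwt hsum hd => ?_
    · exact (mul_le_mul_left (hs.wt_le t ht ha) _).trans (wtBound_mul_call_le hl hc')
    · by_cases h : t ∈ s'.WL
      · exact Or.inl h
      · refine Or.inr ?_
        dsimp only [Goal.Closed]
        rwa [hwt t h]
  -- The guarded insertion never happens: the initialization has already added the self-loops of all
  -- entry states with the fresh mark.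
  · rintro s ⟨hs, hn⟩
    exact absurd (hs.1.added (.entry c.entry) trivial) hn

/-- Needed after an increase of `sum (q, x)`: that value is a factor on the left of exactly the box
goals established here. -/
theorem hoare_returnLoop (hH : HasHeight D H) (hm : m ∉ A.marks) (hA : A.IsConfigAut)
    (q : R.State) (x : R.Exit) {Y : Set (Goal R)} :
    Hoare (potential m A) (Inv m A Y)
      (.forEach (fun s => open scoped Classical in
          (Finset.univ ×ˢ s.aut.Q).filter fun p : R.Ret × R.State =>
            p.1.exit = x ∧ ⟨q, some p.1.box, p.2⟩ ∈ s.aut.trans) fun p =>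
          relax ⟨(.ret p.1, m), none, p.2⟩
            (fun s => s.aut.wt ⟨q, some p.1.box, p.2⟩ * s.sum q x))
      (4 * (returnPairs m A q x).card + 1)
      (Inv m A (Y ∪ ⋃ p ∈ returnPairs m A q x, {.box ⟨q, some p.1.box, p.2⟩ p.1})) := by
  refine (Hoare.forEach (k := fun _ => 3) (T := returnPairs m A q x)
    (fun p : R.Ret × R.State => {Goal.box ⟨q, some p.1.box, p.2⟩ p.1}) (fun s hs => ?_)
    fun p hp Y _ => ?_).weaken (fun _ h => h) (fun _ h => h) (by simp [mul_comm])
  · ext p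
    simp [returnPairs, hs.1.states, hs.1.trans]
  · obtain ⟨r, q'⟩ := p
    simp only [returnPairs, Finset.mem_filter, Finset.mem_product, Finset.mem_univ, true_and] at hp
    obtain ⟨-, rfl, ht⟩ := hp
    refine hoare_relax hH hm hA _ (ht.ret hA rfl) rfl (fun _ => id) (fun s hs => ?_)
      fun s s' hwt hsum hd => ?_
    · exact hs.mul_sum_le hA hm ht rfl
    · by_cases h : ⟨q, some r.box, q'⟩ ∈ s'.WL
      · exact Or.inl h
      · refine Or.inr ?_
        dsimp only [Goal.Closed]
        rwa [hwt _ h, hsum]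

theorem hoare_exitLoop (hH : HasHeight D H) (hm : m ∉ A.marks) (hA : A.IsConfigAut) {t : R.Trans}
    (ht : IsPostTrans m A t) (ha : Active m A t) (hl : t.label = none) {Y : Set (Goal R)} :
    Hoare (potential m A) (Inv m A Y)
      (.forEach (fun _ => exitsFrom t.src.1) fun x =>
        .when (fun s => s.sum t.tgt x + s.aut.wt t ≠ s.sum t.tgt x)
          (.act (fun s => setSum t.tgt x (s.sum t.tgt x + s.aut.wt t) s) ;;
            .forEach (fun s => open scoped Classical in
              (Finset.univ ×ˢ s.aut.Q).filter fun p : R.Ret × R.State =>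
                p.1.exit = x ∧ ⟨t.tgt, some p.1.box, p.2⟩ ∈ s.aut.trans) fun p =>
              relax ⟨(.ret p.1, m), none, p.2⟩
                (fun s => s.aut.wt ⟨t.tgt, some p.1.box, p.2⟩ * s.sum t.tgt x)))
      (2 * (exitsFrom t.src.1).card + 1) (Inv m A (Y ∪ ⋃ x ∈ exitsFrom t.src.1, {.exit t x})) := by
  refine (Hoare.forEach (k := fun _ => 0 + 1) (fun x => {Goal.exit t x}) (fun _ _ => rfl)
    fun x hx Y _ => ?_).weaken (fun _ h => h) (fun _ h => h) (by simp [mul_comm])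
  have hx' : (t.src.1, .exit x) ∈ R.delta := mem_exitsFrom.1 hx
  refine Hoare.when ?_ fun s hs hn => ?_
  -- What survives the update of the summary: every goal except the box goals that multiply by `sum
  -- (t.tgt, x)`. The return loop then restores those.
  · let Z : Set (Goal R) := {g | (∀ t' r, g = .box t' r → ¬ (t'.src = t.tgt ∧ r.exit = x)) ∧
      (g ∈ Y ∨ g = .exit t x)}
    refine Hoare.act_seq_of_release (M := Inv m A Z) (g := sumCost m A x)
      (fun s hs => ?_) ((hoare_returnLoop hH hm hA t.tgt x).weaken (fun _ h => h) (fun s hs => ?_)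
        le_rfl) ?_
    · obtain ⟨⟨hB, hY⟩, hne⟩ := hs
      have hlt : s.sum t.tgt x < s.sum t.tgt x + s.aut.wt t :=
        lt_of_le_of_ne (by rw [add_eq_sup]; exact le_sup_left) hne.symm
      refine ⟨⟨⟨hB.states, hB.trans, hB.init, hB.final, hB.wt_base, hB.wt_loop, hB.wl, hB.added,
        hB.wt_le, fun q y => ?_⟩, ?_⟩, ?_⟩
      · by_cases hq : q = t.tgt
        · subst hq
          by_cases hy : y = x
          · subst hy
            simp only [setSum, Function.update_self]
            rw [add_eq_sup]
            exact sup_le (hB.sum_le _ _)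
              ((hB.wt_le t ht ha).trans (wtBound_le_sumBound hl hx'))
          · simpa [setSum, hy] using hB.sum_le _ _
        · simpa [setSum, hq] using hB.sum_le _ _
      · rintro g ⟨hg, hg' | rfl⟩ hv
        · refine (hY g hg' hv).imp id fun hc => ?_
          cases g with
          | int t' i => exact hc
          | call t' c => exact hc
          | exit t' y =>
            refine le_trans (show s.aut.wt t' ≤ s.sum t'.tgt y from hc) ?_
            by_cases hq : t'.tgt = t.tgt
            · by_cases hy : y = x
              · subst hy
                simp [setSum, hq]
              · simp [setSum, hq, hy]
            · simp [setSum, hq]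
          | box t' r =>
            have hne := hg t' r rfl
            have : (setSum t.tgt x (s.sum t.tgt x + s.aut.wt t) s).sum t'.src r.exit =
                s.sum t'.src r.exit := by
              by_cases hq : t'.src = t.tgt
              · have hy : r.exit ≠ x := fun hy => hne ⟨hq, hy⟩
                simp [setSum, hq, hy]
              · simp [setSum, hq]
            dsimp only [Goal.Closed]
            rw [this]
            exact hc
        · refine Or.inr ?_
          simp only [Goal.Closed, setSum, Function.update_self]
          rw [add_eq_sup]
          exact le_sup_right
      · exact potential_setSum hH (mem_allSums (ht.tgt_mem hA) (ht.tgt_isEntry hA)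
          ((R.delta_mod _ hx').symm.trans (ht.mod_eq hA hl))) hlt
    · refine hs.anti fun g hg hv => ?_
      by_cases hb : ∃ t' r, g = .box t' r ∧ t'.src = t.tgt ∧ r.exit = x
      · obtain ⟨t', r, rfl, h1, h2⟩ := hb
        obtain ⟨hp, hl'⟩ := hv
        obtain ⟨s', l', q'⟩ := t'
        dsimp only at h1 hl'
        subst h1 hl'
        refine Or.inr (Set.mem_iUnion₂.2 ⟨(r, q'), ?_, rfl⟩)
        simpa [returnPairs, h2, hp] using hp.tgt_mem hA
      · refine Or.inl ⟨fun t' r h h' => hb ⟨t', r, h, h'⟩, hg⟩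
    -- The summand 2 in `sumCost` covers the update and the end of the return loop; the factor 4 is
    -- a relaxation and its iteration.
    · have := card_returnPairs_le (m := m) hA t.tgt x
      simp only [sumCost]
      omega
  · refine ⟨hs.1, ?_⟩
    rintro g (hg | rfl) hv
    · exact hs.2 g hg hv
    · refine Or.inr ?_
      dsimp only [Goal.Closed]
      rw [← not_not.1 hn, add_eq_sup]
      exact le_sup_right

/-- Extracting `t` can break only goals about `t`, and the loop bodies establish precisely these
anew. The released `transCost t` covers all the work, so the amortized cost is zero. -/
theorem hoare_iteration (hH : HasHeight D H) (hm : m ∉ A.marks) (hA : A.IsConfigAut) {t : R.Trans}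
    (ht : IsPostTrans m A t) (ha : Active m A t) :
    Hoare (potential m A) (fun s => Inv m A Set.univ s ∧ t ∈ s.WL) (iteration m t) 0
      (Inv m A Set.univ) := by
  classical
  refine Hoare.act_seq_of_release (M := Inv m A {g | g.trans ≠ t}) (g := transCost t)
    (c := transCost t - 1) (fun s hs => ⟨⟨?_, ?_⟩, ?_⟩) ?_ ?_
  · have hB := hs.1.1
    exact ⟨hB.states, hB.trans, hB.init, hB.final, hB.wt_base, hB.wt_loop,
      fun t' ht' => hB.wl t' (Finset.mem_of_mem_erase ht'), hB.added, hB.wt_le, hB.sum_le⟩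
  · intro g hg hv
    refine (hs.1.2 g trivial hv).imp (fun h => Finset.mem_erase.2 ⟨hg, h⟩) fun h => ?_
    cases g <;> exact h
  · exact potential_erase hs.2 (ht.mem_allTrans hA) _ fun t' => by simp
  · have h0 : Hoare (potential m A) (Inv m A {g | g.trans ≠ t}) (.act id) 1
        (Inv m A {g | g.trans ≠ t}) := Hoare.act fun s hs => ⟨hs, by simp [add_comm]⟩
    cases hl : t.label with
    | none =>
      refine (h0.seq ((hoare_intLoop hH hm hA ht ha hl).seq ((hoare_callLoop hH hm hA ht ha hl).seq
        (hoare_exitLoop hH hm hA ht ha hl)))).weaken (fun _ h => h) (fun s hs => ?_) ?_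
      · refine hs.anti fun g _ hv => ?_
        by_cases hg : g.trans = t
        · subst hg
          cases g with
          | int t i => exact Or.inl (Or.inl (Or.inr (Set.mem_iUnion₂.2
              ⟨i, mem_intsFrom.2 hv.2.2.2, rfl⟩)))
          | call t c => exact Or.inl (Or.inr (Set.mem_iUnion₂.2
              ⟨c, mem_callsFrom.2 hv.2.2.2, rfl⟩))
          | exit t x => exact Or.inr (Set.mem_iUnion₂.2
              ⟨x, mem_exitsFrom.2 hv.2.2.2, rfl⟩)
          | box t r => exact absurd (hl.symm.trans hv.2) (by simp)
        · exact Or.inl (Or.inl (Or.inl hg))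
      -- At most 5 steps per outgoing transition, attained by calls; five more for the extraction,
      -- the branching and the ends of three loops.
      · simp only [transCost, hl, outDegree]
        omega
    | some b =>
      have hsnd : t.src.2 = m := (ha.resolve_left fun h => by simp [hl] at h).2
      have h1 : Hoare (potential m A) (Inv m A {g | g.trans ≠ t}) (processBox m t b)
          (4 * (retsOf R b).card + 1)
          (Inv m A ({g | g.trans ≠ t} ∪ ⋃ r ∈ retsOf R b, {.box t r})) := by
        refine (Hoare.forEach (k := fun _ => 3) (T := retsOf R b) (fun r => {Goal.box t r})
          (fun _ _ => rfl) fun r hr Y _ => ?_).weaken (fun _ h => h) (fun _ h => h)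
            (by simp [mul_comm])
        have hr' : t.label = some r.box := by
          rw [hl, mem_retsOf.1 hr]
        -- The algorithm reads the summary at the fresh mark. This is the summary at the source,
        -- since only box transitions with a fresh source enter the worklist.
        have hsrc : (t.src.1, m) = t.src := by rw [← hsnd]
        rw [hsrc]
        refine hoare_relax hH hm hA _ (ht.ret hA hr') rfl (fun _ => id)
          (fun s hs => hs.mul_sum_le hA hm ht hr') fun s s' hwt hsum hd => ?_
        by_cases h : t ∈ s'.WL
        · exact Or.inl h
        · refine Or.inr ?_
          dsimp only [Goal.Closed]
          rwa [hwt _ h, hsum]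
      refine (h0.seq h1).weaken (fun _ h => h) (fun s hs => hs.anti fun g _ hv => ?_) ?_
      · by_cases hg : g.trans = t
        · subst hg
          cases g with
          | int t i => exact absurd (hl.symm.trans hv.2.1) (by simp)
          | call t c => exact absurd (hl.symm.trans hv.2.1) (by simp)
          | exit t x => exact absurd (hl.symm.trans hv.2.1) (by simp)
          | box t r =>
            exact Or.inr (Set.mem_iUnion₂.2
              ⟨r, mem_retsOf.2 (Option.some.inj (hl.symm.trans hv.2)).symm, rfl⟩)
        · exact Or.inl hg
      · simp only [transCost, hl]
        omega
  · have : 1 ≤ transCost t := by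
      unfold transCost
      split <;> omega
    omega

omit [WellFoundedGT D] in
theorem total_iteration (m : Mark) (t : R.Trans) : Total (iteration m t) := by
  refine (Total.act _).seq ((Total.act _).seq ?_)
  have hrelax : ∀ (t : R.Trans) (d : Mem R → D), Total (relax t d) := fun t d s =>
    Total.when ((Total.act _).seq (Total.act _)) s
  cases t.label with
  | none =>
    exact (Total.forEach fun _ => hrelax _ _).seq
      ((Total.forEach fun _ => (hrelax _ _).seq (Total.when (Total.act _))).seq
        (Total.forEach fun _ => Total.when ((Total.act _).seq (Total.forEach fun _ => hrelax _ _))))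
  | some b => exact Total.forEach fun _ => hrelax _ _

end ConfDist

namespace ConfDist

open RSM Prog

variable {D : Type u} [IdemSemiring D] {R : RSM.{u, v} D}

/-! ### Preprocessing and initialization -/

/-- The assertion of the first loop of the preprocessing, after the nodes in `U`. -/
structure StatesAdded (m : Mark) (A : R.Aut) (U : Set R.Node) (s : Mem R) : Prop where
  states : ∀ q, q ∈ s.aut.Q ↔ q ∈ A.Q ∨ (q.2 = m ∧ q.1 ∈ U)
  init : ∀ q, q ∈ s.aut.I ↔ q ∈ A.I ∨ (q.2 = m ∧ q.1 ∈ U)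
  trans : ∀ t, t ∈ s.aut.trans ↔ t ∈ A.trans ∨ ∃ u ∈ U, u.IsEntry ∧ t = loop (u, m)
  final : s.aut.F = A.F
  wt_base : ∀ t ∈ A.trans, s.aut.wt t = 1
  wt_loop : ∀ u ∈ U, u.IsEntry → s.aut.wt (loop (u, m)) = 1
  wl : s.WL = ∅
  sum : ∀ q x, s.sum q x = 0

/-- The transitions of the input and the self-loops of the new entry states. -/
def UnitTrans (m : Mark) (A : R.Aut) (t : R.Trans) : Prop :=
  t ∈ A.trans ∨ ∃ u : R.Node, u.IsEntry ∧ t = loop (u, m)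

/-- What holds after the first loop of the preprocessing, until the main loop. -/
structure Setup (m : Mark) (A : R.Aut) (s : Mem R) : Prop where
  states : s.aut.Q = postStates m A
  init : s.aut.I = postInit m A
  final : s.aut.F = A.F
  wt_one : ∀ t, UnitTrans m A t → s.aut.wt t = 1
  wt_zero : ∀ t ∈ s.aut.trans, ¬ UnitTrans m A t → s.aut.wt t = 0
  isPostTrans : ∀ t ∈ s.aut.trans, IsPostTrans m A t
  sum : ∀ q x, s.sum q x = 0

/-- The assertion of the other loops of the preprocessing: the transitions in `X` are present. -/
def TransAdded (m : Mark) (A : R.Aut) (X : Set R.Trans) (s : Mem R) : Prop :=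
  Setup m A s ∧ s.WL = ∅ ∧ ∀ t ∈ X, t ∈ s.aut.trans

/-- The assertion of the initialization: the transitions in `X` have been inspected. -/
def Inspected (m : Mark) (A : R.Aut) (X : Set R.Trans) (s : Mem R) : Prop :=
  Setup m A s ∧ (∀ t, IsPostTrans m A t → t ∈ s.aut.trans) ∧
    (∀ t ∈ s.WL, IsPostTrans m A t ∧ t.label = none ∧ t.src ∈ postInit m A) ∧
    ∀ t ∈ X, t.label = none → t.src ∈ postInit m A → s.aut.wt t = 1 → t ∈ s.WL ∧ t ∈ s.added

open scoped Classical in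
/-- The entry states after the preprocessing. -/
noncomputable def postEntries (m : Mark) (A : R.Aut) : Finset R.State :=
  (postStates m A).filter fun q => q.1.IsEntry

open scoped Classical in
/-- The entry states of the module `i` after the preprocessing. -/
noncomputable def postEntriesOf (m : Mark) (A : R.Aut) (i : R.Mod) : Finset R.State :=
  (postStates m A).filter fun q => q.1.IsEntry ∧ q.1.mod = i

open scoped Classical in
/-- The internal and return nodes of the module `i`. -/
noncomputable def innerNodesOf (R : RSM.{u, v} D) (i : R.Mod) : Finset R.Node :=
  Finset.univ.filter fun u => ¬ u.IsEntry ∧ u.mod = i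

open scoped Classical in
/-- The exits of the module `i`. -/
noncomputable def exitsOf (R : RSM.{u, v} D) (i : R.Mod) : Finset R.Exit :=
  Finset.univ.filter fun x => R.exitMod x = i

open scoped Classical in
noncomputable def postTrans (m : Mark) (A : R.Aut) : Finset R.Trans :=
  (allTrans m A).filter (IsPostTrans m A)

/-- The cost of the loop that adds the transitions labelled by boxes. -/
noncomputable def boxLoopCost (m : Mark) (A : R.Aut) : ℕ :=
  ∑ q ∈ postInit m A, (∑ _ ∈ callsFrom q.1,
    (∑ _ ∈ postEntriesOf m A q.1.mod, (1 + 1) + 1 + 1) + 1 + 1) + 1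

/-- The cost of the loop that adds the `ε`-transitions. -/
noncomputable def epsLoopCost (m : Mark) (A : R.Aut) : ℕ :=
  ∑ q ∈ postEntries m A, (∑ _ ∈ innerNodesOf R q.1.mod, (1 + 1) + 1 + 1) + 1

/-- The cost of the loop that initializes the summary function. -/
noncomputable def sumLoopCost (m : Mark) (A : R.Aut) : ℕ :=
  ∑ q ∈ postEntries m A, (∑ _ ∈ exitsOf R q.1.mod, (1 + 1) + 1 + 1) + 1

/-- The cost of the preprocessing and the initialization. -/
noncomputable def setupCost (m : Mark) (A : R.Aut) : ℕ :=
  ∑ _ : R.Node, (1 + (1 + (1 + 1)) + 1) + 1 + (boxLoopCost m A + epsLoopCost m A) +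
    (∑ _ ∈ postTrans m A, (1 + 1 + 1) + 1 + sumLoopCost m A)

variable {m : Mark} {A : R.Aut}

theorem UnitTrans.isPostTrans {t : R.Trans} (h : UnitTrans m A t) : IsPostTrans m A t := by
  rcases h with h | ⟨u, hu, rfl⟩
  exacts [.base h, .loop hu]

theorem hoare_addStates (hA : A.IsConfigAut) (h1 : ∀ t ∈ A.trans, A.wt t = 1) (hm : m ∉ A.marks) :
    Hoare (fun _ => 0) (fun s => s = start A)
      (.forEach (fun _ => (Finset.univ : Finset R.Node)) fun u =>
        .act (addState (u, m)) ;;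
        .act (addInit (u, m)) ;;
        .when (fun _ => u.IsEntry) (.act (addTrans ⟨(u, m), none, (u, m)⟩ 1)))
      (∑ _ : R.Node, (1 + (1 + (1 + 1)) + 1) + 1)
      (TransAdded m A {t | UnitTrans m A t}) := by
  classical
  refine (Hoare.forEach (K := StatesAdded m A) (X := ∅) (k := fun _ => 1 + (1 + (1 + 1)))
    (fun u => {u}) (fun _ _ => rfl) fun u _ U _ => ?_).weaken ?_ ?_ le_rfl
  · have hnot : ∀ {t : R.Trans}, t ∈ A.trans → t ≠ loop (u, m) := by
      rintro t ht rfl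
      exact snd_ne_of_mem hm (hA.src_mem _ ht) rfl
    refine Hoare.seq (M := fun s' => ∃ s, StatesAdded m A U s ∧ s' = addState (u, m) s)
      (Hoare.act fun s hs => ⟨⟨s, hs, rfl⟩, by simp⟩) (Hoare.seq
        (M := fun s' => ∃ s, StatesAdded m A U s ∧ s' = addInit (u, m) (addState (u, m) s))
        (Hoare.act ?_) (Hoare.when (Hoare.act ?_) ?_))
    · rintro _ ⟨s, hs, rfl⟩
      exact ⟨⟨s, hs, rfl⟩, by simp⟩
    · rintro _ ⟨⟨s, hs, rfl⟩, hu⟩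
      refine ⟨⟨fun q => ?_, fun q => ?_, fun t => ?_, hs.final, fun t ht => ?_, fun u' hu' he => ?_,
        hs.wl, hs.sum⟩, by simp⟩
      · obtain ⟨u', a⟩ := q
        simp only [addTrans, setWt, addInit, addState, Finset.mem_insert, hs.states, Prod.mk.injEq,
          Set.mem_union, Set.mem_singleton_iff]
        tauto
      · obtain ⟨u', a⟩ := q
        simp only [addTrans, setWt, addInit, addState, Finset.mem_insert, hs.init, Prod.mk.injEq,
          Set.mem_union, Set.mem_singleton_iff]
        tauto
      · simp only [addTrans, setWt, addInit, addState, Finset.mem_insert, hs.trans]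
        constructor
        · rintro (rfl | h | ⟨u', h, h'⟩)
          exacts [Or.inr ⟨u, Or.inr rfl, hu, rfl⟩, Or.inl h, Or.inr ⟨u', Or.inl h, h'⟩]
        · rintro (h | ⟨u', h | rfl, h', rfl⟩)
          exacts [Or.inr (Or.inl h), Or.inr (Or.inr ⟨u', h, h', rfl⟩), Or.inl rfl]
      · simp [addTrans, setWt, addInit, addState, hnot ht, hs.wt_base t ht]
      · by_cases h : u' = u
        · subst h
          simp [addTrans, setWt]
        · have : u' ∈ U := hu'.resolve_right h
          simp [addTrans, setWt, addInit, addState, h, hs.wt_loop u' this he]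
    · rintro _ ⟨s, hs, rfl⟩ hu
      refine ⟨fun q => ?_, fun q => ?_, fun t => ?_, hs.final, hs.wt_base, fun u' hu' he => ?_,
        hs.wl, hs.sum⟩
      · obtain ⟨u', a⟩ := q
        simp only [addInit, addState, Finset.mem_insert, hs.states, Prod.mk.injEq,
          Set.mem_union, Set.mem_singleton_iff]
        tauto
      · obtain ⟨u', a⟩ := q
        simp only [addInit, addState, Finset.mem_insert, hs.init, Prod.mk.injEq,
          Set.mem_union, Set.mem_singleton_iff]
        tauto
      · refine (hs.trans t).trans (or_congr_right ?_)
        constructor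
        · rintro ⟨u', h, h'⟩
          exact ⟨u', Or.inl h, h'⟩
        · rintro ⟨u', h | rfl, h', rfl⟩
          exacts [⟨u', h, h', rfl⟩, absurd h' hu]
      · rcases hu' with h | rfl
        exacts [hs.wt_loop u' h he, absurd he hu]
  · rintro s rfl
    exact ⟨by simp [start], by simp [start], by simp [start], rfl, h1, by simp, rfl, fun _ _ => rfl⟩
  · intro s hs
    have htrans : ∀ t, t ∈ s.aut.trans ↔ UnitTrans m A t := fun t => by
      rw [hs.trans]; simp [UnitTrans]
    refine ⟨⟨?_, ?_, hs.final, ?_, fun t ht h => absurd ((htrans t).1 ht) h,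
      fun t ht => ((htrans t).1 ht).isPostTrans, hs.sum⟩, hs.wl, fun t ht => (htrans t).2 ht⟩
    · ext q
      rw [hs.states, mem_postStates]; simp
    · ext q
      rw [hs.init, mem_postInit]; simp
    · rintro t (ht | ⟨u, hu, rfl⟩)
      exacts [hs.wt_base t ht, hs.wt_loop u (by simp) hu]

theorem not_unitTrans (hA : A.IsConfigAut) (hm : m ∉ A.marks) {t : R.Trans} (hs : t.src.2 = m)
    (hl : t.label = none → ¬ t.src.1.IsEntry) : ¬ UnitTrans m A t := by
  rintro (h | ⟨u, hu, rfl⟩)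
  exacts [snd_ne_of_mem hm (hA.src_mem _ h) hs, hl rfl hu]

/-- The added transition is neither in `A` nor a new self-loop, so writing weight zero overwrites no
weight one. Adding it repeatedly is harmless. -/
theorem hoare_addTrans (hA : A.IsConfigAut) (hm : m ∉ A.marks) {t : R.Trans}
    (ht : IsPostTrans m A t) (hs : t.src.2 = m) (hl : t.label = none → ¬ t.src.1.IsEntry)
    {Y : Set R.Trans} :
    Hoare (fun _ => 0) (TransAdded m A Y) (.act (addTrans t 0)) 1 (TransAdded m A (Y ∪ {t})) := by
  classical
  have hnot := not_unitTrans hA hm hs hl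
  refine Hoare.act fun s ⟨hs, hwl, hY⟩ => ⟨⟨⟨hs.states, hs.init, hs.final, fun t' ht' => ?_,
    fun t' ht' hn => ?_, fun t' ht' => ?_, hs.sum⟩, hwl, ?_⟩, by simp⟩
  · have : t' ≠ t := fun h => hnot (h ▸ ht')
    simp [addTrans, setWt, this, hs.wt_one t' ht']
  · rcases Finset.mem_insert.1 ht' with rfl | h
    · simp [addTrans, setWt]
    · by_cases h' : t' = t
      · simp [addTrans, setWt, h']
      · simp [addTrans, setWt, h', hs.wt_zero t' h hn]
  · rcases Finset.mem_insert.1 ht' with rfl | h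
    exacts [ht, hs.isPostTrans t' h]
  · rintro t' (h | rfl)
    exacts [Finset.mem_insert_of_mem (hY t' h), Finset.mem_insert_self _ _]

theorem hoare_preprocess (hA : A.IsConfigAut) (h1 : ∀ t ∈ A.trans, A.wt t = 1)
    (hm : m ∉ A.marks) :
    Hoare (fun _ => 0) (fun s => s = start A) (preprocess m)
      (∑ _ : R.Node, (1 + (1 + (1 + 1)) + 1) + 1 + (boxLoopCost m A + epsLoopCost m A))
      (Inspected m A ∅) := by
  classical
  have hbox : ∀ X, Hoare (fun _ => 0) (TransAdded m A X)
      (.forEach (fun s => s.aut.I) fun q =>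
        .forEach (fun _ => callsFrom q.1) fun c =>
          .forEach (entryStatesOf q.1.mod) fun q' =>
            .act (addTrans ⟨(.entry c.entry, m), some c.box, q'⟩ 0))
      (boxLoopCost m A)
      (TransAdded m A (X ∪ ⋃ q ∈ postInit m A, ⋃ c ∈ callsFrom q.1,
        ⋃ q' ∈ postEntriesOf m A q.1.mod, {⟨(.entry c.entry, m), some c.box, q'⟩})) := by
    refine fun X => Hoare.forEach _ (fun s hs => hs.1.init) fun q _ Y _ =>
      Hoare.forEach _ (fun _ _ => rfl) fun c hc Z _ => Hoare.forEach _ (fun s hs => ?_)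
        fun q' hq' W _ => ?_
    · ext q'
      simp [entryStatesOf, postEntriesOf, hs.1.states]
    · obtain ⟨hq, he, hmod⟩ := Finset.mem_filter.1 hq'
      exact hoare_addTrans hA hm (.box (mem_callsFrom.1 hc) hq he hmod) rfl (fun h => by cases h)
  have heps : ∀ X, Hoare (fun _ => 0) (TransAdded m A X)
      (.forEach entryStates fun q =>
        .forEach (fun _ => open scoped Classical in
            Finset.univ.filter fun u : R.Node => ¬ u.IsEntry ∧ u.mod = q.1.mod) fun u =>
          .act (addTrans ⟨(u, m), none, q⟩ 0))
      (epsLoopCost m A)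
      (TransAdded m A (X ∪ ⋃ q ∈ postEntries m A, ⋃ u ∈ innerNodesOf R q.1.mod,
        {⟨(u, m), none, q⟩})) := by
    refine fun X => Hoare.forEach _ (fun s hs => ?_) fun q hq Y _ =>
      Hoare.forEach _ (fun _ _ => rfl) fun u hu Z _ => ?_
    · ext q
      simp [entryStates, postEntries, hs.1.states]
    · obtain ⟨hq, he⟩ := Finset.mem_filter.1 hq
      obtain ⟨-, hu, hmod⟩ := Finset.mem_filter.1 hu
      exact hoare_addTrans hA hm (.eps hu hq he hmod) rfl (fun _ => hu)
  refine ((hoare_addStates hA h1 hm).seq ((hbox _).seq (heps _))).weaken (fun _ h => h) ?_ le_rfl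
  rintro s ⟨hs, hwl, hX⟩
  refine ⟨hs, fun t ht => hX t ?_, by simp [hwl], by simp⟩
  cases ht with
  | base h => exact Or.inl (Or.inl (Or.inl h))
  | loop h => exact Or.inl (Or.inl (Or.inr ⟨_, h, rfl⟩))
  | @box u c q hc hq he hmod =>
    -- The preprocessing loops over initial states only, but every node is initial under the fresh
    -- mark, so every call transition of `R` is met.
    refine Or.inl (Or.inr (Set.mem_iUnion₂.2 ⟨(u, m), mem_postInit.2 (Or.inr rfl),
      Set.mem_iUnion₂.2 ⟨c, mem_callsFrom.2 hc, Set.mem_iUnion₂.2 ⟨q, ?_, rfl⟩⟩⟩))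
    exact Finset.mem_filter.2 ⟨hq, he, hmod⟩
  | @eps u q hu hq he hmod =>
    exact Or.inr (Set.mem_iUnion₂.2 ⟨q, Finset.mem_filter.2 ⟨hq, he⟩,
      Set.mem_iUnion₂.2 ⟨u, Finset.mem_filter.2 ⟨Finset.mem_univ _, hu, hmod⟩, rfl⟩⟩)

theorem hoare_initStep (hA : A.IsConfigAut) :
    Hoare (fun _ => 0) (Inspected m A ∅) (initStep (R := R))
      (∑ _ ∈ postTrans m A, (1 + 1 + 1) + 1 + sumLoopCost m A)
      (Inspected m A {t | IsPostTrans m A t}) := by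
  classical
  have hwl : Hoare (fun _ => 0) (Inspected m A ∅)
      (.forEach (fun s => s.aut.trans) fun t =>
        .when (fun s => t.label = none ∧ t.src ∈ s.aut.I ∧ s.aut.wt t = 1) (.act (addWL t)))
      (∑ t ∈ postTrans m A, (1 + 1 + 1) + 1)
      (Inspected m A (∅ ∪ ⋃ t ∈ postTrans m A, {t})) := by
    refine Hoare.forEach _ (fun s hs => ?_) fun t ht Y _ => Hoare.when (Hoare.act ?_) ?_
    · ext t
      simp only [postTrans, Finset.mem_filter]
      exact ⟨fun h => ⟨(hs.1.isPostTrans t h).mem_allTrans hA, hs.1.isPostTrans t h⟩,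
        fun h => hs.2.1 t h.2⟩
    · rintro s ⟨⟨hs, htr, hW, hY⟩, hl, hI, hwt⟩
      rw [hs.init] at hI
      refine ⟨⟨⟨hs.states, hs.init, hs.final, hs.wt_one, hs.wt_zero, hs.isPostTrans, hs.sum⟩, htr,
        fun t' ht' => ?_, ?_⟩, by simp⟩
      · rcases Finset.mem_insert.1 ht' with rfl | h
        exacts [⟨(Finset.mem_filter.1 ht).2, hl, hI⟩, hW t' h]
      · rintro t' (h | rfl) h1 h2 h3
        · obtain ⟨h4, h5⟩ := hY t' h h1 h2 h3
          exact ⟨Finset.mem_insert_of_mem h4, Finset.mem_insert_of_mem h5⟩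
        · exact ⟨Finset.mem_insert_self _ _, Finset.mem_insert_self _ _⟩
    · rintro s ⟨hs, htr, hW, hY⟩ hn
      refine ⟨hs, htr, hW, ?_⟩
      rintro t' (h | rfl) h1 h2 h3
      · exact hY t' h h1 h2 h3
      · exact absurd ⟨h1, by rwa [hs.init], h3⟩ hn
  have hsum : Hoare (fun _ => 0) (Inspected m A {t | IsPostTrans m A t})
      (.forEach entryStates fun q =>
        .forEach (fun _ => open scoped Classical in
            Finset.univ.filter fun x : R.Exit => R.exitMod x = q.1.mod) fun x =>
          .act (setSum q x 0))
      (sumLoopCost m A) (Inspected m A {t | IsPostTrans m A t}) := by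
    -- The summaries are zero from the start, so this loop preserves a fixed assertion and
    -- contributes nothing but cost.
    refine Hoare.forEach (β := Unit) (X := ∅) (K := fun _ => Inspected m A {t | IsPostTrans m A t})
      (fun _ => ∅) (fun s hs => ?_) fun q _ Y _ =>
        Hoare.forEach (K := fun _ => Inspected m A {t | IsPostTrans m A t}) (X := Y) (fun _ => ∅)
          (fun _ _ => rfl) fun x _ Z _ => Hoare.act ?_
    · ext q
      simp [entryStates, postEntries, hs.1.states]
    · rintro s ⟨hs, htr, hW, hY⟩
      refine ⟨⟨⟨hs.states, hs.init, hs.final, hs.wt_one, hs.wt_zero, hs.isPostTrans,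
        fun q' x' => ?_⟩, htr, hW, hY⟩, by simp⟩
      by_cases hq : q' = q
      · by_cases hx : x' = x
        · simp [setSum, hq, hx]
        · simpa [setSum, hq, hx] using hs.sum q x'
      · simpa [setSum, hq] using hs.sum q' x'
  refine (hwl.weaken (fun _ h => h) (fun s hs => ?_) le_rfl).seq hsum
  obtain ⟨hs, htr, hW, hY⟩ := hs
  exact ⟨hs, htr, hW, fun t ht => hY t (Or.inr (Set.mem_iUnion₂.2
    ⟨t, Finset.mem_filter.2 ⟨IsPostTrans.mem_allTrans hA ht, ht⟩, rfl⟩))⟩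

variable [WellFoundedGT D]

/-- Initially an active transition has weight zero, or it is a unit transition bounded by the empty
computation. Goals about `ε`-transitions outside the worklist have left side zero by weight, and box
goals by the zero summaries. -/
theorem Inspected.inv (hA : A.IsConfigAut) (hm : m ∉ A.marks) {s : Mem R}
    (h : Inspected m A {t | IsPostTrans m A t} s) : Inv m A Set.univ s := by
  obtain ⟨hs, htr, hW, hX⟩ := h
  refine ⟨⟨hs.states, fun t => ⟨hs.isPostTrans t, htr t⟩, hs.init, hs.final,
    fun t ht => hs.wt_one t (Or.inl ht), fun u hu => hs.wt_one _ (Or.inr ⟨u, hu, rfl⟩),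
    fun t ht => ⟨(hW t ht).1, Or.inl (hW t ht).2⟩, fun u hu => ?_, fun t ht ha => ?_,
    fun q x => ?_⟩, ?_⟩
  · exact (hX _ (IsPostTrans.loop hu) rfl (mem_postInit.2 (Or.inr rfl))
      (hs.wt_one _ (Or.inr ⟨u, hu, rfl⟩))).2
  · by_cases hu : UnitTrans m A t
    · rw [hs.wt_one t hu]
      rcases hu with h | ⟨u, -, rfl⟩
      · have hne := snd_ne_of_mem hm (hA.src_mem t h)
        rcases ha with ⟨-, hI⟩ | ⟨-, h'⟩
        · exact one_le_wtBound_of_init hA hm h ((mem_postInit.1 hI).resolve_right hne)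
        · exact absurd h' hne
      · exact one_le_wtBound_loop u
    · rw [hs.wt_zero t (htr t ht) hu]
      exact zero_le
  · rw [hs.sum]
    exact zero_le
  · have key : ∀ t, IsPostTrans m A t → t.label = none → t.src ∈ postInit m A → t ∉ s.WL →
        s.aut.wt t = 0 := by
      intro t ht hl hI hn
      refine hs.wt_zero t (htr t ht) fun hu => hn (hX t ht hl hI (hs.wt_one t hu)).1
    intro g _ hv
    refine or_iff_not_imp_left.2 fun hn => ?_
    cases g with
    | int t i => simp [Goal.Closed, key t hv.1 hv.2.1 hv.2.2.1 hn]
    | call t c => simp [Goal.Closed, key t hv.1 hv.2.1 hv.2.2.1 hn]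
    | exit t x => simp [Goal.Closed, key t hv.1 hv.2.1 hv.2.2.1 hn]
    | box t r => simp [Goal.Closed, hs.sum]

theorem hoare_setup (hA : A.IsConfigAut) (h1 : ∀ t ∈ A.trans, A.wt t = 1) (hm : m ∉ A.marks) :
    Hoare (fun _ => 0) (fun s => s = start A) (preprocess m ;; initStep) (setupCost m A)
      (Inv m A Set.univ) :=
  ((hoare_preprocess hA h1 hm).seq (hoare_initStep hA)).weaken (fun _ h => h)
    (fun _ h => h.inv hA hm) le_rfl

omit [WellFoundedGT D] in
theorem total_setup (m : Mark) : Total (preprocess m ;; initStep (R := R)) :=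
  Total.seq
    ((Total.forEach fun _ => (Total.act _).seq ((Total.act _).seq (Total.when (Total.act _)))).seq
      ((Total.forEach fun _ => Total.forEach fun _ => Total.forEach fun _ => Total.act _).seq
        (Total.forEach fun _ => Total.forEach fun _ => Total.act _)))
    ((Total.forEach fun _ => Total.when (Total.act _)).seq
      (Total.forEach fun _ => Total.forEach fun _ => Total.act _))

/-- Iterations have amortized cost zero, so the steps taken plus the remaining potential never
exceed the setup cost plus a uniform bound on the potential. -/
theorem Reaches.inv {H : ℕ} (hH : HasHeight D H) (hA : A.IsConfigAut)
    (h1 : ∀ t ∈ A.trans, A.wt t = 1) (hm : m ∉ A.marks) {C : ℕ}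
    (hC : ∀ s, potential m A s ≤ C) {s : Mem R} {n : ℕ} (h : Reaches m A s n) :
    Inv m A Set.univ s ∧ n + potential m A s ≤ setupCost m A + C := by
  induction h with
  | @init s n h =>
    obtain ⟨h2, h3⟩ := hoare_setup hA h1 hm _ rfl _ h
    refine ⟨h2, ?_⟩
    have := hC s
    dsimp only at h3
    omega
  | step _ t ht h ih =>
    obtain ⟨hp, ha⟩ := ih.1.1.wl t ht
    obtain ⟨h2, h3⟩ := hoare_iteration hH hm hA hp ha _ ⟨ih.1, ht⟩ _ h
    refine ⟨h2, ?_⟩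
    have := ih.2
    dsimp only at h3
    omega

end ConfDist

namespace ConfDist

open RSM Prog

variable {D : Type u} [IdemSemiring D] {R : RSM.{u, v} D} {m : Mark} {A : R.Aut}
  [WellFoundedGT D]

/-! ### The output -/

theorem Base.isConfigAut (hA : A.IsConfigAut) {s : Mem R} (h : Base m A s) :
    s.aut.IsConfigAut where
  src_mem t ht := by rw [h.states]; exact ((h.trans t).1 ht).src_mem hA
  tgt_mem t ht := by rw [h.states]; exact ((h.trans t).1 ht).tgt_mem hA
  wellFormed t ht := ((h.trans t).1 ht).wellFormed hA
  init_sub q hq := by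
    rw [h.init, mem_postInit] at hq
    rw [h.states, mem_postStates]
    exact hq.imp_left fun hq => hA.init_sub hq
  final_sub q hq := by
    rw [h.states, mem_postStates]
    exact Or.inl (hA.final_sub (h.final ▸ hq))
  final_entry q hq := hA.final_entry q (h.final ▸ hq)
  loop_mem := by
    rintro ⟨u, a⟩ hq he
    rw [h.states, mem_postStates] at hq
    rcases hq with hq | rfl
    exacts [(h.trans _).2 (.base (hA.loop_mem _ hq he)), (h.trans _).2 (.loop he)]
  loop_wt := by
    rintro ⟨u, a⟩ hq he
    rw [h.states, mem_postStates] at hq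
    rcases hq with hq | rfl
    exacts [h.wt_base _ (hA.loop_mem _ hq he), h.wt_loop u he]

/-- The fresh mark occurs only if `R` has a node at all; a state of `A` supplies one. -/
theorem Base.card_marks (hm : m ∉ A.marks) (hpos : 0 < A.marks.card) {s : Mem R}
    (h : Base m A s) : s.aut.marks.card = A.marks.card + 1 := by
  classical
  rw [← Finset.card_insert_of_notMem hm]
  congr 1
  obtain ⟨a, ha⟩ := Finset.card_pos.1 hpos
  obtain ⟨q, -, -⟩ := Finset.mem_image.1 ha
  ext b
  simp only [Aut.marks, h.states, Finset.mem_image, mem_postStates, Finset.mem_insert]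
  constructor
  · rintro ⟨p, hp | rfl, rfl⟩
    exacts [Or.inr ⟨p, hp, rfl⟩, Or.inl rfl]
  · rintro (rfl | ⟨p, hp, rfl⟩)
    exacts [⟨(q.1, b), Or.inr rfl, rfl⟩, ⟨p, Or.inl hp, rfl⟩]

/-! ### Upper bound: accepting runs of the output do not exceed the distance. -/

/-- The combine of the weights of the computations that start from a node and a stack accepted
by `A`. -/
noncomputable def reachValue (A : R.Aut) (c : R.Node × List R.Box) : D :=
  combine {v | ∃ c₀ : R.Node × List R.Box,
    (∃ a, (c₀.1, a) ∈ A.I ∧ ∃ q ∈ A.F, ∃ v₀, A.Run (c₀.1, a) c₀.2 v₀ q) ∧ RawComp c₀ v c}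

/-- The bound on the weight of a run that leads from the entry state `q` to a final state. -/
def SuffixBound (m : Mark) (A : R.Aut) (q : R.State) (S : List R.Box) (v : D) : Prop :=
  (q.2 = m → v ≤ reachValue A (q.1, S)) ∧
    (q.2 ≠ m → v = 1 ∧ ∃ f ∈ A.F, ∃ v₀, A.Run q S v₀ f)

/-- Since run weights multiply in reverse, `v` is the earlier part of the computation. For a fresh
target, that part reaches the single origin. For an old target, `v = 1`, and the run of `A` to the
target joins the remaining run into an accepting run of `A`. -/
theorem Base.mul_wt_le {s : Mem R} (h : Base m A s) {t : R.Trans} (ht : IsPostTrans m A t)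
    (ha : Active m A t) {S : List R.Box} {v : D} (hv : SuffixBound m A t.tgt S v) :
    v * s.aut.wt t ≤ reachValue A (t.src.1, t.label.toList ++ S) := by
  refine (mul_le_mul_right (h.wt_le t ht ha) _).trans ?_
  by_cases hs : t.tgt.2 = m
  · refine (mul_le_mul_left (hv.1 hs) _).trans (combine_mul_combine_le ?_)
    rintro v₁ ⟨c₀, hc₀, h₁⟩ w ⟨c, (⟨-, rfl⟩ | ⟨h', -⟩), hw⟩
    · exact le_combine ⟨c₀, hc₀, h₁.trans (hw.append S)⟩
    · exact absurd hs h'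
  · obtain ⟨rfl, f, hf, v₀, hr⟩ := hv.2 hs
    refine mul_combine_le ?_
    rintro w ⟨c, (⟨h', -⟩ | ⟨-, a, haI, v₁, hr₁⟩), hw⟩
    · exact absurd h' hs
    · rw [one_mul]
      exact le_combine ⟨(c.1, c.2 ++ S), ⟨a, haI, f, hf, _, hr₁.append hr⟩, hw.append S⟩

/-- Transitions from an old state are those of `A` and end in old states. Hence a run visits fresh
states first and then stays in `A`, where all weights are one. -/
theorem Base.suffixBound (hA : A.IsConfigAut) (hm : m ∉ A.marks) {s : Mem R} (h : Base m A s)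
    {q f : R.State} {S : List R.Box} {v : D} (hq : q.1.IsEntry) (hf : f ∈ A.F)
    (hr : s.aut.Run q S v f) : SuffixBound m A q S v := by
  induction hr with
  | refl q _ =>
    have hQ := hA.final_sub hf
    exact ⟨fun h => absurd h (snd_ne_of_mem hm hQ), fun _ => ⟨rfl, q, hf, 1, .refl q hQ⟩⟩
  | @cons t S v f ht hr ih =>
    have htp := (h.trans t).1 ht
    have ih := ih ((h.isConfigAut hA).tgt_isEntry ht) hf
    refine ⟨fun hs => h.mul_wt_le htp (.of_snd hs) ih, fun hs => ?_⟩
    have htA := htp.mem_of_snd_ne hs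
    obtain ⟨rfl, f', hf', v₀, hr'⟩ := ih.2 (snd_ne_of_mem hm (hA.tgt_mem t htA))
    exact ⟨by rw [h.wt_base t htA, mul_one], f', hf', _, .cons htA hr'⟩

/-- `wtBound` controls active transitions only. A box transition from an old initial state is not
active, so the run is first normalized to begin with an `ε`-transition, which is. -/
theorem Base.acceptingRun_le (hA : A.IsConfigAut) (hm : m ∉ A.marks) {s : Mem R} (h : Base m A s)
    {c : R.Config} {v : D} (hv : s.aut.AcceptingRun c v) : v ≤ reachValue A (c.node, c.stack) := by
  obtain ⟨a, haI, f, hf, hr⟩ := hv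
  rw [h.final] at hf
  rw [h.init] at haI
  have hB := h.isConfigAut hA
  obtain ⟨p, v', ht, hr', rfl⟩ := hr.exists_eps hB (hA.final_entry f hf)
  exact h.mul_wt_le ((h.trans _).1 ht) (Or.inl ⟨rfl, haI⟩)
    (h.suffixBound hA hm (hB.tgt_isEntry ht) hf hr')

theorem reachValue_le (h1 : ∀ t ∈ A.trans, A.wt t = 1) (c : R.Config) :
    reachValue A (c.node, c.stack) ≤
      combine {v : D | ∃ c₀ ∈ A.language, Computation c₀ v c} := by
  refine combine_le ?_
  rintro v ⟨⟨u, S⟩, ⟨a, ha, q, hq, v₀, hr⟩, hv⟩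
  -- The language asks for a non-zero weight. Runs of `A` have weight one, so this matters only in
  -- the trivial semiring, where every weight is zero.
  by_cases h01 : (1 : D) = 0
  · rw [← mul_one v, h01, mul_zero]
    exact zero_le
  · have hvalid := hv.validStack_iff.2 c.valid
    refine le_combine ⟨⟨u, S, hvalid⟩, ⟨v₀, ?_, a, ha, q, hq, hr⟩, hv.computation hvalid c.valid⟩
    rwa [hr.weight_eq_one h1]

/-! ### Lower bound: the distance does not exceed the weight of the output. -/

theorem Base.run (h1 : ∀ t ∈ A.trans, A.wt t = 1) {s : Mem R} (h : Base m A s)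
    {q f : R.State} {S : List R.Box} {v : D} (hr : A.Run q S v f) : s.aut.Run q S v f := by
  induction hr with
  | refl q hq => exact .refl q (by rw [h.states, mem_postStates]; exact Or.inl hq)
  | @cons t S v q ht _ ih =>
    rw [show A.wt t = s.aut.wt t by rw [h1 t ht, h.wt_base t ht]]
    exact .cons ((h.trans t).2 (.base ht)) ih

/-- With the worklist empty, all inequalities hold. An internal or call step replaces the first
`ε`-transition of the run. A return step replaces it and the box transition after it by one
`ε`-transition, using the exit inequality and then the box inequality. -/
theorem Inv.step_le (hA : A.IsConfigAut) {s : Mem R} (h : Inv m A Set.univ s) (hWL : s.WL = ∅)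
    {c c' : R.Config} {r w : D} (hr : s.aut.AcceptingRun c r) (hs : Step c w c') :
    r * w ≤ combine {v | s.aut.AcceptingRun c' v} := by
  obtain ⟨hB, hG⟩ := h
  have hclosed : ∀ g : Goal R, g.Valid m A → g.Closed m s := fun g hg =>
    (hG g trivial hg).resolve_left (by simp [hWL])
  have hinit : ∀ u : R.Node, (u, m) ∈ s.aut.I := fun u => by
    rw [hB.init]; exact mem_postInit.2 (Or.inr rfl)
  have hBA := hB.isConfigAut hA
  obtain ⟨a, haI, f, hf, hr⟩ := hr
  have haI' : (c.node, a) ∈ postInit m A := by rwa [← hB.init]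
  obtain ⟨p, v, ht, hr', rfl⟩ := hr.exists_eps hBA (hBA.final_entry f hf)
  have htp := (hB.trans _).1 ht
  cases hs with
  | internal _ i hd hn hs =>
    have hle := hclosed (.int ⟨(c.node, a), none, p⟩ i) ⟨htp, rfl, haI', hd⟩
    rw [mul_assoc]
    refine (mul_le_mul_right hle _).trans (le_combine ⟨m, hinit _, f, hf, ?_⟩)
    rw [hn, hs]
    exact .cons ((hB.trans _).2 (htp.int hA rfl hd)) hr'
  | call _ b hd hn hs =>
    have hle := hclosed (.call ⟨(c.node, a), none, p⟩ b) ⟨htp, rfl, haI', hd⟩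
    rw [mul_assoc]
    refine (mul_le_mul_right hle _).trans (le_combine ⟨m, hinit _, f, hf, ?_⟩)
    rw [hn, hs]
    exact .cons ((hB.trans _).2 (htp.call hA rfl hd)) hr'
  | ret _ x hd hn hs =>
    rw [hs] at hr'
    -- Self-loops of weight one before the box transition are skipped, so the box transition starts
    -- at `p`, where the summary is stored.
    obtain ⟨p', v', ht', hr'', rfl⟩ := hr'.exists_box hBA (htp.tgt_isEntry hA)
    have htp' := (hB.trans _).1 ht'
    have hle : s.aut.wt ⟨(c.node, a), none, p⟩ ≤ s.sum p x.exit :=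
      hclosed (.exit ⟨(c.node, a), none, p⟩ x.exit) ⟨htp, rfl, haI', hd⟩
    have hle' : s.aut.wt ⟨p, some x.box, p'⟩ * s.sum p x.exit ≤ _ :=
      hclosed (.box ⟨p, some x.box, p'⟩ x) ⟨htp', rfl⟩
    rw [R.w_exit _ _ hd, mul_one, mul_assoc]
    refine (mul_le_mul_right ((mul_le_mul_right hle _).trans hle') _).trans
      (le_combine ⟨m, hinit _, f, hf, ?_⟩)
    rw [hn]
    exact .cons ((hB.trans _).2 (htp'.ret hA rfl)) hr''

/-- An accepting run of `A` survives in the output with its weight one, which starts the induction.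
Each further step multiplies on the right, and the combine distributes over that. -/
theorem Inv.computation_le (hA : A.IsConfigAut) (h1 : ∀ t ∈ A.trans, A.wt t = 1) {s : Mem R}
    (h : Inv m A Set.univ s) (hWL : s.WL = ∅) {c₀ c : R.Config} {v : D} (hc₀ : c₀ ∈ A.language)
    (hv : Computation c₀ v c) : v ≤ combine {v | s.aut.AcceptingRun c v} := by
  induction hv with
  | refl =>
    obtain ⟨v₀, -, a, ha, q, hq, hr⟩ := hc₀
    rw [← hr.weight_eq_one h1]
    refine le_combine ⟨a, ?_, q, h.1.final ▸ hq, h.1.run h1 hr⟩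
    rw [h.1.init]
    exact mem_postInit.2 (Or.inl ha)
  | step _ hs ih =>
    exact (mul_le_mul_left ih _).trans
      (combine_mul_le fun r hr => h.step_le hA hWL hr hs)

theorem Inv.isDist_isWeight (hA : A.IsConfigAut) (h1 : ∀ t ∈ A.trans, A.wt t = 1)
    (hm : m ∉ A.marks) {s : Mem R} (h : Inv m A Set.univ s) (hWL : s.WL = ∅) (c : R.Config) :
    ∃ d : D, IsDist A.language c d ∧ s.aut.IsWeight c d := by
  refine ⟨_, isLUB_combine _, fun v hv => (h.1.acceptingRun_le hA hm hv).trans (reachValue_le h1 c),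
    fun b hb => combine_le ?_⟩
  rintro v ⟨c₀, hc₀, hv⟩
  exact (h.computation_le hA h1 hWL hc₀ hv).trans (combine_le hb)

end ConfDist

namespace ConfDist

open RSM Prog

variable {D : Type u} [IdemSemiring D] {R : RSM.{u, v} D} {m : Mark} {A : R.Aut}

/-! ### Counting -/

theorem sum_image_le_sum {α β : Type*} [DecidableEq β] (T : Finset α) (f : α → β) (g : β → ℕ) :
    ∑ b ∈ T.image f, g b ≤ ∑ a ∈ T, g (f a) := by
  classical
  induction T using Finset.induction_on with
  | empty => simp
  | insert a T ha ih =>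
    rw [Finset.image_insert, Finset.sum_insert ha]
    by_cases h : f a ∈ T.image f
    · rw [Finset.insert_eq_of_mem h]; omega
    · rw [Finset.sum_insert h]; omega

theorem card_node_le : Fintype.card R.Node ≤ R.size := by
  refine le_trans ?_ (le_max_left _ _)
  have h := Fintype.card_le_of_surjective
    (fun s : R.Int ⊕ R.Entry ⊕ R.Ret => match s with
      | .inl i => RSMFrame.Node.int i
      | .inr (.inl e) => RSMFrame.Node.entry e
      | .inr (.inr r) => RSMFrame.Node.ret r)
    (fun n => match n with
      | .int i => ⟨.inl i, rfl⟩
      | .entry e => ⟨.inr (.inl e), rfl⟩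
      | .ret r => ⟨.inr (.inr r), rfl⟩)
  rw [Fintype.card_sum, Fintype.card_sum] at h
  unfold RSM.numNodes
  omega

theorem card_exit_le : Fintype.card R.Exit ≤ R.size := by
  refine le_trans ?_ (le_max_left _ _)
  unfold RSM.numNodes
  omega

theorem numCalls_le : R.numCalls ≤ R.size := by
  refine le_trans ?_ (le_max_left _ _)
  unfold RSM.numNodes RSM.numCalls
  omega

theorem sum_outDegree_le : ∑ u : R.Node, outDegree u ≤ R.size := by
  classical
  refine le_trans ?_ (le_max_right _ _)
  rw [Finset.card_eq_sum_card_fiberwise (f := Prod.fst) (t := Finset.univ) fun _ _ => by simp]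
  refine Finset.sum_le_sum fun u _ => ?_
  rw [outDegree, add_assoc, ← Finset.card_disjSum, ← Finset.card_disjSum]
  refine Finset.card_le_card_of_injOn
    (fun s : R.Int ⊕ R.Call ⊕ R.Exit => (u, match s with
      | .inl i => RSMFrame.Target.int i
      | .inr (.inl c) => RSMFrame.Target.call c
      | .inr (.inr x) => RSMFrame.Target.exit x)) ?_ ?_
  · rintro (i | c | x) h
    · simpa [mem_intsFrom] using h
    · simpa [mem_callsFrom] using h
    · simpa [mem_exitsFrom] using h
  · rintro (i | c | x) - (i' | c' | x') - h <;> simp_all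

theorem card_retsOf_le (b : R.Box) : (retsOf R b).card ≤ R.exitBound := by
  classical
  refine le_trans (Finset.card_le_card_of_injOn (t := exitsOf R (R.Y b)) (fun r => r.exit) ?_ ?_)
    (Finset.le_sup (f := fun i => (exitsOf R i).card) (Finset.mem_univ _))
  · intro r hr
    have := mem_retsOf.1 (Finset.mem_coe.1 hr)
    subst this
    exact Finset.mem_filter.2 ⟨Finset.mem_univ _, r.exit_mod⟩
  · intro r hr r' hr' h
    have h1 := mem_retsOf.1 (Finset.mem_coe.1 hr)
    have h2 := mem_retsOf.1 (Finset.mem_coe.1 hr')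
    cases r; cases r'
    simp_all

/-- A return node `(b, x)` with an entry `e` of the module of `x` determines the call node `(b, e)`
and the return node `(b, x)` of the same box. Counting from the call side gives at most `exitBound`
return nodes for each call node. -/
theorem sum_card_mul_card_le :
    ∑ x : R.Exit, (retsAt R x).card * (entriesOf R (R.exitMod x)).card ≤
      R.numCalls * R.exitBound := by
  classical
  calc _ = ((Finset.univ : Finset R.Exit).sigma fun x =>
        retsAt R x ×ˢ entriesOf R (R.exitMod x)).card := by
        simp [Finset.card_sigma, Finset.card_product]
    _ ≤ ((Finset.univ : Finset R.Call).sigma fun c => retsOf R c.box).card := by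
        refine Finset.card_le_card_of_surjOn (fun p => ⟨p.2.exit, p.2, p.1.entry⟩) ?_
        rintro ⟨x, r, e⟩ h
        simp only [retsAt, entriesOf, Finset.coe_sigma, Set.mem_sigma_iff, Finset.mem_coe,
          Finset.mem_univ, true_and, Finset.mem_product, Finset.mem_filter] at h
        obtain ⟨rfl, he⟩ := h
        refine ⟨⟨⟨r.box, e, he.trans r.exit_mod⟩, r⟩, ?_, rfl⟩
        simp [mem_retsOf]
    _ ≤ R.numCalls * R.exitBound := by
        rw [Finset.card_sigma, RSM.numCalls, ← Finset.card_univ, ← smul_eq_mul]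
        exact Finset.sum_le_card_nsmul _ _ _ fun c _ => card_retsOf_le _

/-- For a given source node there are at most `entryBound` target nodes and two free marks. The
degrees and the constant summand each add up to at most `R.size`. -/
theorem sum_epsTrans_le :
    ∑ t ∈ epsTrans m A, transCost t ≤ 10 * (R.size * R.entryBound * (postMarks m A).card ^ 2) := by
  classical
  refine (sum_image_le_sum _ _ _).trans ?_
  rw [Finset.sum_sigma]
  calc _ ≤ ∑ u : R.Node, R.entryBound * (postMarks m A).card ^ 2 * (5 * (outDegree u + 1)) := by
        refine Finset.sum_le_sum fun u _ => ?_
        simp only [transCost, Finset.sum_const, smul_eq_mul, Finset.card_product]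
        rw [← pow_two]
        gcongr
        exact card_entriesOf_le _
    _ = R.entryBound * (postMarks m A).card ^ 2 *
          (5 * (∑ u : R.Node, outDegree u + Fintype.card R.Node)) := by
        rw [← Finset.mul_sum, ← Finset.mul_sum, Finset.sum_add_distrib]
        simp
    _ ≤ R.entryBound * (postMarks m A).card ^ 2 * (5 * (R.size + R.size)) := by
        gcongr
        exacts [sum_outDegree_le, card_node_le]
    _ = _ := by ring

theorem sum_boxTrans_le :
    ∑ t ∈ boxTrans m A, transCost t ≤ 5 * (R.size * R.entryBound * (postMarks m A).card ^ 2) +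
      5 * (R.numCalls * R.entryBound * R.exitBound * (postMarks m A).card ^ 2) := by
  classical
  refine (sum_image_le_sum _ _ _).trans ?_
  rw [Finset.sum_sigma]
  calc _ ≤ ∑ _c : R.Call, R.entryBound * (postMarks m A).card ^ 2 * (5 * (R.exitBound + 1)) := by
        refine Finset.sum_le_sum fun c _ => ?_
        simp only [transCost, Finset.sum_const, smul_eq_mul, Finset.card_product]
        rw [← pow_two]
        gcongr
        exacts [card_entriesOf_le _, card_retsOf_le _]
    _ = 5 * (R.numCalls * R.entryBound * (postMarks m A).card ^ 2) +
          5 * (R.numCalls * R.entryBound * R.exitBound * (postMarks m A).card ^ 2) := by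
        simp only [Finset.sum_const, smul_eq_mul, Finset.card_univ, RSM.numCalls]
        ring
    _ ≤ _ := by
        gcongr
        exact numCalls_le

theorem sum_allTrans_le :
    ∑ t ∈ allTrans m A, transCost t ≤ 15 * (R.size * R.entryBound * (postMarks m A).card ^ 2) +
      5 * (R.numCalls * R.entryBound * R.exitBound * (postMarks m A).card ^ 2) := by
  classical
  have h : ∑ t ∈ allTrans m A, transCost t ≤
      ∑ t ∈ epsTrans m A, transCost t + ∑ t ∈ boxTrans m A, transCost t := by
    rw [allTrans, ← Finset.sum_union_inter]
    exact Nat.le_add_right _ _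
  have h1 := sum_epsTrans_le (m := m) (A := A)
  have h2 := sum_boxTrans_le (m := m) (A := A)
  omega

/-- One factor `entryBound` comes from the targets in the return loop. The entries carrying
summaries are counted exactly, together with the return nodes, so that they merge into the number of
calls. -/
theorem sum_allSums_le :
    ∑ p ∈ allSums m A, sumCost m A p.2 ≤
      4 * (R.numCalls * R.entryBound * R.exitBound * (postMarks m A).card ^ 2) +
      2 * (R.size * R.entryBound * (postMarks m A).card) := by
  classical
  refine (sum_image_le_sum _ _ _).trans ?_
  rw [Finset.sum_sigma]
  calc _ = ∑ x : R.Exit, (4 * (R.entryBound * (postMarks m A).card ^ 2 *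
            ((retsAt R x).card * (entriesOf R (R.exitMod x)).card)) +
          2 * ((postMarks m A).card * (entriesOf R (R.exitMod x)).card)) := by
        refine Finset.sum_congr rfl fun x _ => ?_
        simp only [sumCost, Finset.sum_const, smul_eq_mul, Finset.card_product]
        ring
    _ ≤ ∑ x : R.Exit, (4 * (R.entryBound * (postMarks m A).card ^ 2 *
            ((retsAt R x).card * (entriesOf R (R.exitMod x)).card)) +
          2 * ((postMarks m A).card * R.entryBound)) := by
        gcongr
        exact card_entriesOf_le _
    _ = 4 * (R.entryBound * (postMarks m A).card ^ 2 *
          ∑ x : R.Exit, ((retsAt R x).card * (entriesOf R (R.exitMod x)).card)) +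
          Fintype.card R.Exit * (2 * ((postMarks m A).card * R.entryBound)) := by
        rw [Finset.sum_add_distrib, ← Finset.mul_sum, ← Finset.mul_sum]
        simp
    _ ≤ 4 * (R.entryBound * (postMarks m A).card ^ 2 * (R.numCalls * R.exitBound)) +
          R.size * (2 * ((postMarks m A).card * R.entryBound)) := by
        gcongr
        exacts [sum_card_mul_card_le, card_exit_le]
    _ = _ := by ring

theorem card_postTrans_le : (postTrans m A).card ≤ ∑ t ∈ allTrans m A, transCost t := by
  classical
  refine (Finset.card_le_card (Finset.filter_subset _ _)).trans ?_
  rw [Finset.card_eq_sum_ones]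
  refine Finset.sum_le_sum fun t _ => ?_
  unfold transCost
  split <;> omega

theorem card_postEntriesOf_le (i : R.Mod) :
    (postEntriesOf m A i).card ≤ R.entryBound * (postMarks m A).card := by
  classical
  have hsub : postEntriesOf m A i ⊆ (entriesOf R i ×ˢ postMarks m A).image
      fun p => (RSMFrame.Node.entry p.1, p.2) := by
    intro q hq
    obtain ⟨hq, he, hi⟩ := Finset.mem_filter.1 hq
    have hmark := mem_postMarks hq
    obtain ⟨e, a, rfl⟩ := exists_entry he
    exact Finset.mem_image.2 ⟨(e, a), Finset.mem_product.2
      ⟨Finset.mem_filter.2 ⟨Finset.mem_univ _, hi⟩, hmark⟩, rfl⟩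
  refine (Finset.card_le_card hsub).trans (Finset.card_image_le.trans ?_)
  rw [Finset.card_product]
  exact Nat.mul_le_mul_right _ (card_entriesOf_le i)

theorem postStates_subset : postStates m A ⊆ Finset.univ ×ˢ postMarks m A := fun _ hq =>
  Finset.mem_product.2 ⟨Finset.mem_univ _, mem_postMarks hq⟩

theorem card_postEntries_le :
    (postEntries m A).card ≤ R.size * (postMarks m A).card := by
  classical
  refine (Finset.card_le_card ((Finset.filter_subset _ _).trans postStates_subset)).trans ?_
  rw [Finset.card_product, Finset.card_univ]
  exact Nat.mul_le_mul_right _ card_node_le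

/-- Double counting of pairs of an entry state and an element in the same module: each element meets
only the entry states of its own module. -/
theorem sum_postEntries_card_le {β : Type*} [Fintype β] (g : β → R.Mod)
    (S : R.Mod → Finset β) (hS : ∀ i, ∀ b ∈ S i, g b = i) :
    ∑ q ∈ postEntries m A, (S q.1.mod).card ≤
      Fintype.card β * (R.entryBound * (postMarks m A).card) := by
  classical
  calc _ ≤ ∑ q ∈ postEntries m A,
        ((Finset.univ : Finset β).bipartiteAbove (fun q b => g b = q.1.mod) q).card := by
        refine Finset.sum_le_sum fun q _ => Finset.card_le_card fun b hb => ?_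
        exact Finset.mem_filter.2 ⟨Finset.mem_univ _, hS _ b hb⟩
    _ = ∑ b : β, ((postEntries m A).bipartiteBelow (fun q b => g b = q.1.mod) b).card :=
        Finset.sum_card_bipartiteAbove_eq_sum_card_bipartiteBelow _
    _ ≤ _ := by
        rw [← Finset.card_univ, ← smul_eq_mul]
        refine Finset.sum_le_card_nsmul _ _ _ fun b _ =>
          le_trans (Finset.card_le_card ?_) (card_postEntriesOf_le (g b))
        intro q hq
        obtain ⟨hq, hb⟩ := Finset.mem_filter.1 hq
        obtain ⟨hq, he⟩ := Finset.mem_filter.1 hq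
        exact Finset.mem_filter.2 ⟨hq, he, hb.symm⟩

theorem epsLoopCost_le :
    epsLoopCost m A ≤ 2 * (R.size * R.entryBound * (postMarks m A).card) +
      2 * (R.size * (postMarks m A).card) + 1 := by
  classical
  have h := sum_postEntries_card_le (m := m) (A := A) RSMFrame.Node.mod (innerNodesOf R)
    fun i u hu => (Finset.mem_filter.1 hu).2.2
  have h1 := card_postEntries_le (m := m) (A := A)
  have h2 : Fintype.card R.Node * (R.entryBound * (postMarks m A).card) ≤
      R.size * R.entryBound * (postMarks m A).card := by
    rw [mul_assoc]; exact Nat.mul_le_mul_right _ card_node_le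
  have h3 : epsLoopCost m A =
      2 * ∑ q ∈ postEntries m A, (innerNodesOf R q.1.mod).card + 2 * (postEntries m A).card + 1 := by
    simp only [epsLoopCost, Finset.sum_const, smul_eq_mul, Finset.sum_add_distrib, Finset.mul_sum]
    simp only [mul_comm]
    ring
  omega

theorem sumLoopCost_le :
    sumLoopCost m A ≤ 2 * (R.size * R.entryBound * (postMarks m A).card) +
      2 * (R.size * (postMarks m A).card) + 1 := by
  classical
  have h := sum_postEntries_card_le (m := m) (A := A) R.exitMod (exitsOf R)
    fun i u hu => (Finset.mem_filter.1 hu).2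
  have h1 := card_postEntries_le (m := m) (A := A)
  have h2 : Fintype.card R.Exit * (R.entryBound * (postMarks m A).card) ≤
      R.size * R.entryBound * (postMarks m A).card := by
    rw [mul_assoc]; exact Nat.mul_le_mul_right _ card_exit_le
  have h3 : sumLoopCost m A =
      2 * ∑ q ∈ postEntries m A, (exitsOf R q.1.mod).card + 2 * (postEntries m A).card + 1 := by
    simp only [sumLoopCost, Finset.sum_const, smul_eq_mul, Finset.sum_add_distrib, Finset.mul_sum]
    simp only [mul_comm]
    ring
  omega

theorem boxLoopCost_le (hA : A.IsConfigAut) :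
    boxLoopCost m A ≤ 2 * (R.size * R.entryBound * (postMarks m A).card ^ 2) +
      4 * (R.size * (postMarks m A).card) + 1 := by
  classical
  have hsub : postInit m A ⊆ Finset.univ ×ˢ postMarks m A := fun q hq =>
    postStates_subset (mem_postStates.2 ((mem_postInit.1 hq).imp_left fun h => hA.init_sub h))
  unfold boxLoopCost
  refine Nat.add_le_add_right ?_ 1
  calc _ ≤ ∑ q ∈ postInit m A,
        (outDegree q.1 * (2 * (R.entryBound * (postMarks m A).card) + 2) + 2) := by
        refine Finset.sum_le_sum fun q _ => Nat.add_le_add_right (Nat.add_le_add_right ?_ 1) 1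
        rw [Finset.sum_const, smul_eq_mul]
        refine Nat.mul_le_mul (by unfold outDegree; omega) ?_
        rw [Finset.sum_const, smul_eq_mul]
        have := card_postEntriesOf_le (m := m) (A := A) q.1.mod
        omega
    _ ≤ ∑ q ∈ (Finset.univ : Finset R.Node) ×ˢ postMarks m A,
        (outDegree q.1 * (2 * (R.entryBound * (postMarks m A).card) + 2) + 2) :=
        Finset.sum_le_sum_of_subset hsub
    _ = (postMarks m A).card * ((∑ u : R.Node, outDegree u) *
          (2 * (R.entryBound * (postMarks m A).card) + 2) + 2 * Fintype.card R.Node) := by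
        rw [Finset.sum_product]
        simp only [Finset.sum_const, smul_eq_mul, ← Finset.mul_sum, Finset.sum_add_distrib,
          ← Finset.sum_mul, Finset.card_univ]
        ring
    _ ≤ (postMarks m A).card * (R.size *
          (2 * (R.entryBound * (postMarks m A).card) + 2) + 2 * R.size) := by
        gcongr
        exacts [sum_outDegree_le, card_node_le]
    _ = _ := by ring

/-! ### The total number of steps. -/

/-- A bound for the potential. -/
noncomputable def potentialBound (H : ℕ) (m : Mark) (A : R.Aut) : ℕ :=
  (∑ t ∈ allTrans m A, transCost t) * (H + 1) + (∑ p ∈ allSums m A, sumCost m A p.2) * H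

theorem potential_le {H : ℕ} (hH : HasHeight D H) (s : Mem R) :
    potential m A s ≤ potentialBound H m A := by
  classical
  unfold potential potentialBound
  rw [Finset.sum_mul, Finset.sum_mul]
  gcongr
  · exact hH.chainRank_le _
  · split_ifs <;> omega
  · exact hH.chainRank_le _

theorem totalCost_le {H κ : ℕ} (hH : HasHeight D H) (hA : A.IsConfigAut) (hm : m ∉ A.marks)
    (hκ : A.marks.card = κ) (hκ0 : 0 < κ) (hθ : 0 < R.entryBound) :
    setupCost m A + potentialBound H m A ≤ 500 * (H * (R.size * R.entryBound * κ ^ 2 +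
      R.numCalls * R.entryBound * R.exitBound * κ ^ 3)) := by
  classical
  have hM : (postMarks m A).card = κ + 1 := by
    rw [postMarks, Finset.card_insert_of_notMem hm, hκ]
  -- A mark of `A` comes with a node, so `R.size` is positive and absorbs the additive constants.
  have hN : 0 < R.size := by
    obtain ⟨a, ha⟩ := Finset.card_pos.1 (hκ ▸ hκ0)
    obtain ⟨q, -, -⟩ := Finset.mem_image.1 ha
    exact (Fintype.card_pos_iff.2 ⟨q.1⟩).trans_le card_node_le
  have hH0 := hH.pos
  have e1 := sum_allTrans_le (m := m) (A := A)
  have e2 := sum_allSums_le (m := m) (A := A)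
  have e3 := card_postTrans_le (m := m) (A := A)
  have e4 := epsLoopCost_le (m := m) (A := A)
  have e5 := sumLoopCost_le (m := m) (A := A)
  have e6 := boxLoopCost_le (m := m) hA
  have e7 := card_node_le (R := R)
  have hsetup : setupCost m A = 5 * Fintype.card R.Node + 1 + (boxLoopCost m A + epsLoopCost m A) +
      (3 * (postTrans m A).card + 1 + sumLoopCost m A) := by
    simp only [setupCost, Finset.sum_const, smul_eq_mul, Finset.card_univ]
    ring
  rw [hsetup, potentialBound]
  rw [hM] at e1 e2 e4 e5 e6
  generalize ∑ t ∈ allTrans m A, transCost t = a at *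
  generalize ∑ p ∈ allSums m A, sumCost m A p.2 = b at *
  generalize R.size = N at *
  generalize R.entryBound = θ at *
  generalize R.numCalls = K at *
  generalize R.exitBound = X at *
  have hk : (κ + 1) ^ 2 ≤ 4 * κ ^ 2 := by nlinarith
  have hk1 : κ + 1 ≤ 4 * κ ^ 2 := by nlinarith
  have hZ : N * θ * (κ + 1) ^ 2 ≤ 4 * (N * θ * κ ^ 2) :=
    (Nat.mul_le_mul_left _ hk).trans_eq (by ring)
  have hZ1 : N * θ * (κ + 1) ≤ 4 * (N * θ * κ ^ 2) :=
    (Nat.mul_le_mul_left _ hk1).trans_eq (by ring)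
  have hZ2 : N * (κ + 1) ≤ N * θ * (κ + 1) :=
    Nat.mul_le_mul_right _ (Nat.le_mul_of_pos_right N hθ)
  have hZ3 : N ≤ N * (κ + 1) := Nat.le_mul_of_pos_right N (Nat.succ_pos κ)
  -- The count gives only the square of the number of marks in this term; the cube is a weakening,
  -- valid since `κ` is positive.
  have hV : K * θ * X * (κ + 1) ^ 2 ≤ 4 * (K * θ * X * κ ^ 3) :=
    (Nat.mul_le_mul_left _ (hk.trans (Nat.mul_le_mul_left 4
      (Nat.pow_le_pow_right hκ0 (by norm_num : 2 ≤ 3))))).trans_eq (by ring)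
  generalize N * θ * (κ + 1) ^ 2 = z1 at *
  generalize N * θ * (κ + 1) = z2 at *
  generalize N * (κ + 1) = z3 at *
  generalize K * θ * X * (κ + 1) ^ 2 = v1 at *
  generalize N * θ * κ ^ 2 = Z at *
  generalize K * θ * X * κ ^ 3 = V at *
  have ha : a ≤ 60 * Z + 20 * V := by omega
  have hb : b ≤ 8 * Z + 16 * V := by omega
  have hs : 5 * Fintype.card R.Node + 1 + (boxLoopCost m A + epsLoopCost m A) +
      (3 * (postTrans m A).card + 1 + sumLoopCost m A) ≤ 292 * (Z + V) := by omega
  -- The potential has `H + 1` because of the worklist indicator; `H + 1 ≤ 2 * H` as a height is at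
  -- least one. The coefficients of `H * Z` and `H * V` sum to 428 and 348, below 500.
  calc _ ≤ 292 * (Z + V) * H + (60 * Z + 20 * V) * (2 * H) + (8 * Z + 16 * V) * H := by
        rw [← add_assoc]
        gcongr
        · exact hs.trans (Nat.le_mul_of_pos_right _ hH0)
        · omega
    _ ≤ 500 * (H * (Z + V)) := by nlinarith [Nat.zero_le (H * Z), Nat.zero_le (H * V)]

end ConfDist

/-! ### The theorem. -/

theorem mainTheorem1 :
    ∃ C : ℕ, ∀ (D : Type u) [IdemSemiring D] (H : ℕ), HasHeight D H →
      ∀ (R : RSM.{u, v} D) (A : R.Aut), A.IsConfigAut → (∀ t ∈ A.trans, A.wt t = 1) →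
      ∀ (κ : ℕ), A.marks.card = κ → ∀ (m : Mark), m ∉ A.marks →
        -- all executions take at most `T` elementary steps
        (∃ T : ℕ, (∀ s n, ConfDist.Reaches m A s n → n ≤ T) ∧
          (0 < κ → 0 < R.entryBound →
            T ≤ C * (H * (R.size * R.entryBound * κ ^ 2
              + R.numCalls * R.entryBound * R.exitBound * κ ^ 3)))) ∧
        -- executions never get stuck
        (∃ s n, ConfDist.Reaches m A s n) ∧
        (∀ s n, ConfDist.Reaches m A s n → ∀ t ∈ s.WL,
          ∃ s' k, (s', k) ∈ ConfDist.iteration m t s) ∧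
        -- the output of every halting execution
        (∀ s n, ConfDist.Reaches m A s n → s.WL = ∅ →
          s.aut.IsConfigAut ∧
          (0 < κ → s.aut.marks.card = κ + 1) ∧
          ∀ c : R.Config, ∃ d : D, RSM.IsDist A.language c d ∧ s.aut.IsWeight c d) := by
  refine ⟨500, fun D _ H hH R A hA h1 κ hκ m hm => ?_⟩
  have := hH.wellFoundedGT
  have hinv : ∀ s n, ConfDist.Reaches m A s n → _ := fun s n h =>
    h.inv hH hA h1 hm (ConfDist.potential_le hH)
  refine ⟨⟨_, fun s n h => (Nat.le_add_right _ _).trans (hinv s n h).2,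
    ConfDist.totalCost_le hH hA hm hκ⟩, ?_, fun s n _ t _ => ?_, fun s n h hWL => ?_⟩
  · obtain ⟨⟨s, n⟩, h⟩ := ConfDist.total_setup m (ConfDist.start A)
    exact ⟨s, n, .init h⟩
  · obtain ⟨⟨s', k⟩, h⟩ := ConfDist.total_iteration m t s
    exact ⟨s', k, h⟩
  · have hI := (hinv s n h).1
    exact ⟨hI.1.isConfigAut hA, fun h0 => hκ ▸ hI.1.card_marks hm (hκ ▸ h0),
      hI.isDist_isWeight hA h1 hm hWL⟩
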